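/- Fix a sleep rate $\lambda>0$ and $p\in(0,1)$. In the Activated Random Walk model on $\mathbb{Z}$, each active particle performs a continuous-time random walk with jump rate $1$, jumping to the left neighbour with probability $p$ and to the right neighbour with probability $1-p$; an active particle which is alone on its site falls asleep at rate $\lambda$; a sleeping particle does not move and is instantaneously reactivated when another particle arrives on its site. For $n\ge 1$ let $V_n=\{1,\dots,n\}$. The driven-dissipative Markov chain on $V_n$ has as its states the configurations on $V_n$ in which each site is either empty or contains exactly one sleeping particle; at each step, one active particle is added at a uniformly chosen site of $V_n$, and the system evolves, particles being killed when they jump out of $V_n$, until no active particle remains. This chain has exactly one stationary distribution; let $S_n$ denote the number of sleeping particles in a configuration sampled from it. Then, for all $n,m\ge 1$, the variable $S_{n+m+1}$ stochastically dominates $S_n+S'_m$, where $S'_m$ is a copy of $S_m$ independent of $S_n$; that is, $\mathbb{P}(S_{n+m+1}\ge t)\ \ge\ \mathbb{P}(S_n+S'_m\ge t)$ for every $t$. -/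

import Mathlib

open MeasureTheory ProbabilityTheory
open scoped ENNReal

namespace ARW

/-- The content of one site: `active k` means `k` active particles (so `active 0` is an empty
site), `sleeping` means exactly one sleeping particle. -/
inductive SiteState : Type
  | active (k : ℕ)
  | sleeping

namespace SiteState

/-- The number of active particles. -/
def numActive : SiteState → ℕ
  | active k => k
  | sleeping => 0

/-- The number of sleeping particles. -/
def numSleeping : SiteState → ℕ
  | active _ => 0
  | sleeping => 1

/-- One active particle arrives; a sleeping particle already there wakes up at once. -/
def receive : SiteState → SiteState
  | active k => active (k + 1)
  | sleeping => active 2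

/-- One active particle leaves (only used when there is one). -/
def release : SiteState → SiteState
  | active k => active (k - 1)
  | sleeping => sleeping

/-- A lone active particle falls asleep; anything else is unchanged. -/
def fallAsleep : SiteState → SiteState
  | active 1 => sleeping
  | s => s

/-- The rate at which a particle falls asleep: `lam` for a lone active particle, else `0`. -/
def sleepRate (lam : ℝ) : SiteState → ℝ
  | active 1 => lam
  | _ => 0

end SiteState

/-- Particle configurations on a finite set `V` of integer sites. -/
abbrev Config (V : Finset ℤ) : Type := V → SiteState

/-- A configuration is stable if it has no active particle. -/
def IsStable {V : Finset ℤ} (η : Config V) : Prop :=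
  ∀ x, (η x).numActive = 0

/-- An active particle arrives at the integer `y`; it is killed if `y` is outside `V`. -/
def addParticle {V : Finset ℤ} (η : Config V) (y : ℤ) : Config V :=
  fun z => if (z : ℤ) = y then (η z).receive else η z

/-- One active particle jumps from the site `x` to the integer `y`. -/
def jump {V : Finset ℤ} (η : Config V) (x : V) (y : ℤ) : Config V :=
  addParticle (Function.update η x (η x).release) y

/-- The kinds of elementary events at a site. -/
inductive Event : Type
  | left
  | right
  | sleep
  deriving DecidableEq

instance : Fintype Event :=
  ⟨{Event.left, Event.right, Event.sleep}, fun e => by cases e <;> simp⟩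

/-- The effect of an elementary event at the site `x`. -/
def applyEvent {V : Finset ℤ} (η : Config V) : V × Event → Config V
  | (x, Event.left) => jump η x ((x : ℤ) - 1)
  | (x, Event.right) => jump η x ((x : ℤ) + 1)
  | (x, Event.sleep) => Function.update η x (η x).fallAsleep

/-- The rates of the continuous-time dynamics with sleep rate `lam` and probability `p` to jump
to the left: each active particle jumps at rate `1`, a lone active particle falls asleep at
rate `lam`. -/
noncomputable def rate (lam p : ℝ) {V : Finset ℤ} (η : Config V) : V × Event → ℝ≥0∞
  | (x, Event.left) => ENNReal.ofReal ((η x).numActive * p)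
  | (x, Event.right) => ENNReal.ofReal ((η x).numActive * (1 - p))
  | (x, Event.sleep) => ENNReal.ofReal ((η x).sleepRate lam)

theorem tsum_rate_ne_top (lam p : ℝ) {V : Finset ℤ} (η : Config V) :
    ∑' e, rate lam p η e ≠ ∞ := by
  rw [tsum_fintype]
  refine ENNReal.sum_ne_top.2 ?_
  rintro ⟨x, _ | _ | _⟩ _ <;> exact ENNReal.ofReal_ne_top

open Classical in
/-- The law of the configuration right after the next elementary event of the continuous-time
dynamics started from `η`: each event is the next one with probability proportional to its rate.
If no event has a positive rate (i.e. `η` is stable), the configuration stays put. -/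
noncomputable def step (lam p : ℝ) {V : Finset ℤ} (η : Config V) : PMF (Config V) :=
  if h : ∑' e, rate lam p η e = 0 then PMF.pure η
  else (PMF.normalize (rate lam p η) h (tsum_rate_ne_top lam p η)).map (applyEvent η)

/-- The law of the configuration after `k` elementary events, started from `η`. -/
noncomputable def evolve (lam p : ℝ) {V : Finset ℤ} (η : Config V) : ℕ → PMF (Config V)
  | 0 => PMF.pure η
  | k + 1 => (evolve lam p η k).bind (step lam p)

/-- Stable configurations on `V`, i.e. the state space of the driven-dissipative chain. -/
abbrev StableConfig (V : Finset ℤ) : Type := {η : Config V // IsStable η}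

/-- The probability that the system started from `η` is eventually frozen in the stable
configuration `ξ`. As `ξ` is absorbing, the events "the system is in `ξ` after `k` elementary
events" increase with `k`, and this is the probability of their union. -/
noncomputable def stabProb (lam p : ℝ) {V : Finset ℤ} (η : Config V) (ξ : StableConfig V) :
    ℝ≥0∞ :=
  ⨆ k, evolve lam p η k ξ.1

/-- Transition probabilities of the driven-dissipative chain on `V`: an active particle is added
at a uniformly chosen site of `V`, and the system evolves until it is stable. -/
noncomputable def ddProb (lam p : ℝ) {V : Finset ℤ} (η ξ : StableConfig V) : ℝ≥0∞ :=
  ∑ x : V, (V.card : ℝ≥0∞)⁻¹ * stabProb lam p (addParticle η.1 (x : ℤ)) ξ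

/-- Stationary distributions of the driven-dissipative chain on `V`. -/
def IsStationary (lam p : ℝ) {V : Finset ℤ} (π : PMF (StableConfig V)) : Prop :=
  ∀ ξ, ∑' η, π η * ddProb lam p η ξ = π ξ

/-- The segment `{1, …, n}`. -/
noncomputable def segment (n : ℕ) : Finset ℤ := Finset.Icc 1 (n : ℤ)

/-- The number of sleeping particles in a stable configuration. -/
def countSleeping {V : Finset ℤ} (η : StableConfig V) : ℕ :=
  ∑ x : V, (η.1 x).numSleeping

/-- The law on `ℕ` of the number of sleeping particles in a configuration with law `π`. -/
noncomputable def sleepingLaw {V : Finset ℤ} (π : PMF (StableConfig V)) : Measure ℕ :=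
  (π.map countSleeping).toMeasure

end ARW

/-! The dynamics is replaced by topplings: an active site makes a sleep attempt with probability `s
= lam / (1 + lam)` and otherwise sends a particle to a neighbour. The mean of a payoff `g` after the
stabilisation of a set `U` of sites is the only function that is preserved by every toppling of an
active site of `U` and equals `g` where `U` is stable. This `value` carries the argument: laws are
compared by a maximum principle, without any coupling. That the order of topplings is irrelevant is
the abelian property.

The stationary law on a segment is the law of the stabilisation of `full`: if every site is active,
the value after one more arrival at `z` is harmonic in `z`, and at the two killing sites nothing is
added, so arrivals do not matter.

Let `c` be the middle site of `{1, …, n + m + 1}`. If the particles at `c` are stuck, the two sides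
of `full` are stabilised independently, and the number of particles left outside `c` has the law of
`S_n + S'_m` (`value_compl_middle`). It remains to see that releasing the particles at `c` does not
lower the probability that at least `t` particles stay (`value_compl_le_value_univ`). At most `j`
jumps from `c` are allowed (`budgetValue`), and `j` increases. The last jump, say to the left,
amounts to an extra particle at `c - 1`. If the left side has no sleeping particle, this does no
harm: the probability after an arrival at `z` is superharmonic in `z`, because a sleeping particle
is at least as good as an awake one (`value_atLeast_wakeAt_le`), and an arrival at `0` or at `c`
changes nothing. The abelian property allows this assumption (`value_nonneg_of_side`): if the
particle nearest to `c` is always moved first, no sleeping particle is left on that side when one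
reaches `c`. Left and right jumps are treated separately, each with its own order of topplings. -/

namespace ARW

open Filter Topology

/-! ### Topplings, their commutation, and the maximum principle -/

section Toppling

namespace SiteState

/-- The number of particles. -/
def count (a : SiteState) : ℕ := a.numActive + a.numSleeping

theorem receive_release_comm {a : SiteState} (h : 0 < a.numActive) :
    a.receive.release = a.release.receive := by
  rcases a with k | _
  · simp only [numActive] at h
    simp only [receive, release, active.injEq]
    omega
  · simp [numActive] at h

theorem receive_fallAsleep_comm {a : SiteState} (h : 0 < a.numActive) :
    a.receive.fallAsleep = a.fallAsleep.receive := by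
  rcases a with (_ | _ | k) | _
  · simp [numActive] at h
  · rfl
  · rfl
  · simp [numActive] at h

theorem fallAsleep_of_two_le {a : SiteState} (h : 2 ≤ a.numActive) : a.fallAsleep = a := by
  rcases a with (_ | _ | k) | _ <;> simp_all [numActive, fallAsleep]

theorem numActive_receive_pos (a : SiteState) : 0 < a.receive.numActive := by
  rcases a with k | _ <;> simp [numActive, receive]

theorem count_receive (a : SiteState) : a.receive.count = a.count + 1 := by
  rcases a with k | _ <;> simp [count, numActive, receive, numSleeping]

theorem count_fallAsleep (a : SiteState) : a.fallAsleep.count = a.count := by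
  rcases a with (_ | _ | k) | _ <;> simp [count, numActive, fallAsleep, numSleeping]

theorem count_release {a : SiteState} (h : 0 < a.numActive) :
    a.release.count + 1 = a.count := by
  rcases a with k | _ <;> simp_all [count, numActive, release, numSleeping]
  omega

theorem finite_count_le (M : ℕ) : {a : SiteState | a.count ≤ M}.Finite := by
  refine (((Set.finite_Iic M).image active).union (Set.finite_singleton sleeping)).subset ?_
  rintro (k | _) h
  · exact Or.inl ⟨k, by simpa [count, numActive, numSleeping] using h, rfl⟩
  · exact Or.inr rfl

end SiteState

variable {V : Finset ℤ}

/-- The site `x` contains an active particle. -/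
def Act (η : Config V) (x : V) : Prop := 0 < (η x).numActive

/-- The effect on the site `z` of an event at the site `x`. -/
def localEffect (x : ℤ) : Event → ℤ → SiteState → SiteState
  | .left, z, a => if z = x then a.release else if z = x - 1 then a.receive else a
  | .right, z, a => if z = x then a.release else if z = x + 1 then a.receive else a
  | .sleep, z, a => if z = x then a.fallAsleep else a

theorem applyEvent_apply (η : Config V) (x : V) (e : Event) (z : V) :
    applyEvent η (x, e) z = localEffect x e z (η z) := by
  by_cases h : z = x
  · subst h
    cases e <;> simp [applyEvent, jump, addParticle, localEffect]
    intro h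
    omega
  · have h' : (z : ℤ) ≠ x := fun h' => h (Subtype.ext h')
    cases e <;> simp [applyEvent, jump, addParticle, localEffect, h, h']

/-- Arrivals commute with releases and sleep attempts at a site that has an active particle. At an
empty site they do not, hence the hypothesis at `x` and `y`. -/
theorem localEffect_comm {x y z : ℤ} (hxy : x ≠ y) (e f : Event) {a : SiteState}
    (h : z = x ∨ z = y → 0 < a.numActive) :
    localEffect x e z (localEffect y f z a) = localEffect y f z (localEffect x e z a) := by
  by_cases hx : z = x
  · subst hx
    have h := h (Or.inl rfl)
    cases e <;> cases f <;> simp only [localEffect, hxy, if_true, if_false] <;> split_ifs <;>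
      simp [SiteState.receive_release_comm h, SiteState.receive_fallAsleep_comm h]
  · by_cases hy : z = y
    · subst hy
      have h := h (Or.inr rfl)
      cases e <;> cases f <;> simp only [localEffect, hx, if_true, if_false] <;> split_ifs <;>
        simp [SiteState.receive_release_comm h, SiteState.receive_fallAsleep_comm h]
    · cases e <;> cases f <;> simp only [localEffect, hx, hy, if_false] <;> split_ifs <;> rfl

theorem applyEvent_comm {η : Config V} {x y : V} (hxy : x ≠ y) (hx : Act η x) (hy : Act η y)
    (e f : Event) :
    applyEvent (applyEvent η (y, f)) (x, e) = applyEvent (applyEvent η (x, e)) (y, f) := by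
  funext z
  simp only [applyEvent_apply]
  refine localEffect_comm (fun h => hxy (Subtype.ext h)) e f ?_
  rintro (h | h)
  · rw [Subtype.ext h]; exact hx
  · rw [Subtype.ext h]; exact hy

theorem applyEvent_addParticle {η : Config V} {x : V} (hx : Act η x) (e : Event) (y : ℤ) :
    applyEvent (addParticle η y) (x, e) = addParticle (applyEvent η (x, e)) y := by
  funext z
  simp only [applyEvent_apply, addParticle]
  by_cases h : z = x
  · subst h
    have h1 := SiteState.receive_release_comm hx
    have h2 := SiteState.receive_fallAsleep_comm hx
    cases e <;> simp only [localEffect, if_true] <;> split_ifs <;> simp [h1, h2]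
  · have h' : (z : ℤ) ≠ x := fun h' => h (Subtype.ext h')
    cases e <;> simp only [localEffect, h', if_false] <;> split_ifs <;> rfl

theorem addParticle_of_notMem (η : Config V) {y : ℤ} (hy : y ∉ V) : addParticle η y = η := by
  funext z
  simp only [addParticle]
  rw [if_neg]
  rintro rfl
  exact hy z.2

theorem act_addParticle_self (η : Config V) (x : V) : Act (addParticle η x) x := by
  simp [Act, addParticle, SiteState.numActive_receive_pos]

theorem Act.addParticle {η : Config V} {x : V} (h : Act η x) (y : ℤ) :
    Act (addParticle η y) x := by
  unfold Act ARW.addParticle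
  split_ifs
  · exact SiteState.numActive_receive_pos _
  · exact h

theorem Act.applyEvent {η : Config V} {x y : V} (hxy : x ≠ y) (h : Act η x) (e : Event) :
    Act (applyEvent η (y, e)) x := by
  have h' : (x : ℤ) ≠ y := fun h' => hxy (Subtype.ext h')
  unfold Act
  rw [applyEvent_apply]
  cases e <;> simp only [localEffect, h', if_false] <;> (try split_ifs) <;>
    first | exact h | exact SiteState.numActive_receive_pos _

/-- If an event at an active site makes the site `z` active, then `z` is next to that site. -/
theorem act_applyEvent_cases {η : Config V} {x z : V} {e : Event}
    (h : Act (ARW.applyEvent η (x, e)) z) : Act η z ∨ (z : ℤ) = x - 1 ∨ (z : ℤ) = x + 1 := by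
  by_cases h1 : (z : ℤ) = x - 1
  · exact Or.inr (Or.inl h1)
  by_cases h2 : (z : ℤ) = x + 1
  · exact Or.inr (Or.inr h2)
  left
  unfold Act at h ⊢
  rw [applyEvent_apply] at h
  revert h
  cases e <;> simp only [localEffect, h1, h2, if_false] <;> split_ifs with h3 <;>
    rcases η z with (_ | _ | k) | _ <;> simp [SiteState.numActive, SiteState.release,
      SiteState.fallAsleep]

/-- The number of particles, each one counted with the weight of its site. -/
def weight (w : ℤ → ℕ) (η : Config V) : ℕ := ∑ x : V, w x * (η x).count

theorem weight_update_add (w : ℤ → ℕ) (η : Config V) (x : V) (a : SiteState) (k : ℕ)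
    (h : a.count + k = (η x).count) :
    weight w (Function.update η x a) + k * w x = weight w η := by
  have : k * w x = ∑ z : V, if z = x then k * w z else 0 := by simp
  unfold weight
  rw [this, ← Finset.sum_add_distrib]
  refine Finset.sum_congr rfl fun z _ => ?_
  by_cases hz : z = x
  · subst hz
    simp [← h]; ring
  · simp [hz]

theorem weight_addParticle_le (w : ℤ → ℕ) (η : Config V) (y : ℤ) :
    weight w (addParticle η y) ≤ weight w η + w y := by
  have : ∀ z : V, w z * (addParticle η y z).count
      = w z * (η z).count + if (z : ℤ) = y then w z else 0 := by
    intro z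
    unfold addParticle
    split_ifs
    · rw [SiteState.count_receive]; ring
    · rw [add_zero]
  unfold weight
  rw [Finset.sum_congr rfl fun z _ => this z, Finset.sum_add_distrib]
  gcongr
  by_cases hy : y ∈ V
  · rw [Finset.sum_eq_single ⟨y, hy⟩]
    · simp
    · intro b _ hb
      rw [if_neg]
      exact fun h => hb (Subtype.ext h)
    · simp
  · rw [Finset.sum_eq_zero]
    · simp
    · intro b _
      rw [if_neg]
      rintro rfl
      exact hy b.2

theorem weight_jump_le (w : ℤ → ℕ) {η : Config V} {x : V} (hx : Act η x) (y : ℤ) :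
    weight w (jump η x y) + w x ≤ weight w η + w y := by
  have h1 := weight_addParticle_le w (Function.update η x (η x).release) y
  have h2 := weight_update_add w η x (η x).release 1 (SiteState.count_release hx)
  unfold jump
  omega

theorem weight_sleep (w : ℤ → ℕ) (η : Config V) (x : V) :
    weight w (applyEvent η (x, Event.sleep)) = weight w η := by
  simpa [applyEvent] using
    weight_update_add w η x (η x).fallAsleep 0 (SiteState.count_fallAsleep _)

theorem weight_applyEvent_le (w : ℤ → ℕ) {η : Config V} {x : V} (hx : Act η x) (e : Event)
    (h1 : w (x - 1) ≤ w x) (h2 : w (x + 1) ≤ w x) :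
    weight w (applyEvent η (x, e)) ≤ weight w η := by
  cases e with
  | left => have := weight_jump_le w hx (x - 1); simp only [applyEvent]; omega
  | right => have := weight_jump_le w hx (x + 1); simp only [applyEvent]; omega
  | sleep => exact (weight_sleep w η x).le

/-- The number of particles. -/
def total (η : Config V) : ℕ := weight (fun _ => 1) η

theorem total_applyEvent_le {η : Config V} {x : V} (hx : Act η x) (e : Event) :
    total (applyEvent η (x, e)) ≤ total η :=
  weight_applyEvent_le _ hx e le_rfl le_rfl

theorem finite_total_le (M : ℕ) : {η : Config V | total η ≤ M}.Finite := by
  refine (Set.Finite.pi' (t := fun _ : V => {a : SiteState | a.count ≤ M})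
    fun _ => SiteState.finite_count_le M).subset ?_
  intro η hη x
  refine le_trans ?_ (show total η ≤ M from hη)
  simp only [total, weight, one_mul]
  exact Finset.single_le_sum (f := fun x : V => (η x).count) (fun _ _ => Nat.zero_le _)
    (Finset.mem_univ x)

/-- The mean of `u` after a jump from `x`. -/
def jumpAvg (p : ℝ) (x : V) (u : Config V → ℝ) (η : Config V) : ℝ :=
  p * u (applyEvent η (x, .left)) + (1 - p) * u (applyEvent η (x, .right))

/-- The mean of `u` after a toppling of `x`, which is a sleep attempt with probability `s`. -/
def topple (s p : ℝ) (x : V) (u : Config V → ℝ) (η : Config V) : ℝ :=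
  s * u (applyEvent η (x, .sleep)) + (1 - s) * jumpAvg p x u η

/-- A positive maximum would be passed on to points of ever smaller `Φ`, which is impossible in `ℕ`.
-/
theorem nonpos_of_maximizer_descends {X : Type*} {S : Set X} (hS : S.Finite) (w : X → ℝ)
    (Φ : X → ℕ) (h : ∀ x ∈ S, 0 < w x → (∀ z ∈ S, w z ≤ w x) → ∃ y ∈ S, Φ y < Φ x ∧ w x ≤ w y) :
    ∀ x ∈ S, w x ≤ 0 := by
  intro x hx
  by_contra! hpos
  obtain ⟨m, hm, hmax⟩ := hS.exists_maximalFor w S ⟨x, hx⟩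
  have hmax : ∀ z ∈ S, w z ≤ w m := fun z hz =>
    (le_total (w z) (w m)).elim id fun h => hmax hz h
  have key : ∀ k, ∀ y ∈ S, Φ y = k → w m ≤ w y → False := by
    intro k
    induction k using Nat.strong_induction_on with
    | _ k ih =>
      intro y hy hk hwy
      obtain ⟨z, hz, hlt, hle⟩ := h y hy (hpos.trans_le ((hmax x hx).trans hwy))
        fun z hz => (hmax z hz).trans hwy
      exact ih _ (hk ▸ hlt) z hz rfl (hwy.trans hle)
  exact key _ m hm rfl le_rfl

theorem one_le_of_mem_segment {N : ℕ} (x : segment N) : 1 ≤ (x : ℤ) :=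
  (Finset.mem_Icc.1 x.2).1

/-- The sleep probability of a toppling, and the probability that a jump is to the left. -/
structure Params where
  s : ℝ
  p : ℝ
  s_nonneg : 0 ≤ s
  s_lt_one : s < 1
  p_pos : 0 < p
  p_lt_one : p < 1

variable {N : ℕ} (P : Params)

/-- Maximum principle: a function that is at most a mean over the outcomes of the toppling of
some active site wherever it is positive is nonpositive. -/
theorem max_principle {p : ℝ} (hp0 : 0 < p) (hp1 : p < 1) (C : Set (Config (segment N)))
    (w : Config (segment N) → ℝ)
    (h : ∀ η ∈ C, 0 < w η → ∃ x, Act η x ∧ ∃ s, 0 ≤ s ∧ s < 1 ∧ w η ≤ topple s p x w η ∧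
      ∀ e, 0 < w (applyEvent η (x, e)) → applyEvent η (x, e) ∈ C) :
    ∀ η ∈ C, w η ≤ 0 := by
  intro η₀ hη₀
  -- Topplings create no particles, so only finitely many configurations matter.
  let S : Set (Config (segment N)) := {η | total η ≤ total η₀ ∧ (η ∈ C ∨ w η ≤ 0)}
  have hS : S.Finite := (finite_total_le (total η₀)).subset fun η h => h.1
  refine nonpos_of_maximizer_descends hS w (weight Int.toNat) ?_ η₀ ⟨le_rfl, Or.inl hη₀⟩
  rintro η ⟨htot, hC⟩ hpos hmax
  obtain ⟨x, hx, s, hs0, hs1, hle, hout⟩ := h η (hC.resolve_right hpos.not_ge) hpos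
  have hmem : ∀ e, applyEvent η (x, e) ∈ S := fun e =>
    ⟨(total_applyEvent_le hx e).trans htot, by
      by_cases h : 0 < w (applyEvent η (x, e))
      · exact Or.inl (hout e h)
      · exact Or.inr (not_lt.1 h)⟩
  -- The potential is the sum of the positions of the particles, which a left jump lowers. A left
  -- jump has positive probability because `s < 1` and `0 < p`, so it leads from a maximiser to a
  -- maximiser.
  refine ⟨_, hmem .left, ?_, ?_⟩
  · have h1 := weight_jump_le Int.toNat hx (x - 1)
    have h2 := one_le_of_mem_segment x
    simp only [applyEvent]
    omega
  · have hS := hmax _ (hmem .sleep)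
    have hL := hmax _ (hmem .left)
    have hR := hmax _ (hmem .right)
    unfold topple jumpAvg at hle
    by_contra! hlt
    have h1 : p * w (applyEvent η (x, .left)) < p * w η := mul_lt_mul_of_pos_left hlt hp0
    have h2 : (1 - p) * w (applyEvent η (x, .right)) ≤ (1 - p) * w η :=
      mul_le_mul_of_nonneg_left hR (by linarith)
    have h3 : s * w (applyEvent η (x, .sleep)) ≤ s * w η := mul_le_mul_of_nonneg_left hS hs0
    have h4 : (1 - s) * (p * w (applyEvent η (x, .left)) + (1 - p) * w (applyEvent η (x, .right)))
        < (1 - s) * (w η) := mul_lt_mul_of_pos_left (by linarith) (by linarith)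
    linarith

end Toppling

/-! ### Existence and uniqueness of values, abelian property -/

section Value

variable {N : ℕ}

/-- No site of `U` contains an active particle. -/
def StableOn (U : Set ℤ) {V : Finset ℤ} (η : Config V) : Prop :=
  ∀ x : V, (x : ℤ) ∈ U → ¬ Act η x

/-- The topplings of the active sites of `U` in the configuration `η` preserve the mean of `u`. -/
def HarmonicAt (P : Params) (U : Set ℤ) {V : Finset ℤ} (u : Config V → ℝ) (η : Config V) : Prop :=
  ∀ x : V, (x : ℤ) ∈ U → Act η x → u η = topple P.s P.p x u η

theorem topple_sub {V : Finset ℤ} (s p : ℝ) (x : V) (u v : Config V → ℝ) (η : Config V) :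
    topple s p x (fun η => u η - v η) η = topple s p x u η - topple s p x v η := by
  unfold topple jumpAvg; ring

theorem topple_add {V : Finset ℤ} (s p : ℝ) (x : V) (u v : Config V → ℝ) (η : Config V) :
    topple s p x (fun η => u η + v η) η = topple s p x u η + topple s p x v η := by
  unfold topple jumpAvg; ring

theorem topple_const_mul {V : Finset ℤ} (s p a : ℝ) (x : V) (u : Config V → ℝ) (η : Config V) :
    topple s p x (fun η => a * u η) η = a * topple s p x u η := by
  unfold topple jumpAvg; ring

theorem topple_const {V : Finset ℤ} (s p a : ℝ) (x : V) (η : Config V) :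
    topple s p x (fun _ => a) η = a := by
  unfold topple jumpAvg; ring

theorem topple_sum {V : Finset ℤ} {ι : Type*} (I : Finset ι) (s p : ℝ) (x : V)
    (u : ι → Config V → ℝ) (η : Config V) :
    topple s p x (fun η => ∑ i ∈ I, u i η) η = ∑ i ∈ I, topple s p x (u i) η := by
  simp only [topple, jumpAvg, Finset.sum_add_distrib, Finset.mul_sum, mul_add]

theorem topple_congr {V : Finset ℤ} (s p : ℝ) (x : V) {u v : Config V → ℝ} {η η' : Config V}
    (h : ∀ e, u (applyEvent η (x, e)) = v (applyEvent η' (x, e))) :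
    topple s p x u η = topple s p x v η' := by
  simp only [topple, jumpAvg, h]

theorem Params.topple_mono (P : Params) {V : Finset ℤ} (x : V) {u v : Config V → ℝ} {η : Config V}
    (h : ∀ e, u (applyEvent η (x, e)) ≤ v (applyEvent η (x, e))) :
    topple P.s P.p x u η ≤ topple P.s P.p x v η := by
  have h1 := P.s_nonneg
  have h2 := P.s_lt_one
  have h3 := P.p_pos
  have h4 := P.p_lt_one
  unfold topple jumpAvg
  have := sub_nonneg.2 h2.le
  have := sub_nonneg.2 h4.le
  gcongr <;> exact h _

theorem topple_comm {V : Finset ℤ} (s p : ℝ) {x y : V} (hxy : x ≠ y) (u : Config V → ℝ)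
    {η : Config V} (hx : Act η x) (hy : Act η y) :
    topple s p x (topple s p y u) η = topple s p y (topple s p x u) η := by
  simp only [topple, jumpAvg, applyEvent_comm hxy hx hy]
  ring

/-- Wherever `U` is not stable, the difference equals its mean over a toppling in `U`, so its sign
is decided at the configurations that are stable on `U`. -/
theorem le_of_harmonicAt {P : Params} {U : Set ℤ} {C : Set (Config (segment N))}
    {u v : Config (segment N) → ℝ}
    (hC : ∀ η ∈ C, ∀ x : segment N, (x : ℤ) ∈ U → Act η x → ∀ e, applyEvent η (x, e) ∈ C)
    (hu : ∀ η ∈ C, HarmonicAt P U u η) (hv : ∀ η ∈ C, HarmonicAt P U v η)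
    (h : ∀ η ∈ C, StableOn U η → u η ≤ v η) : ∀ η ∈ C, u η ≤ v η := by
  intro η hη
  rw [← sub_nonpos]
  refine max_principle P.p_pos P.p_lt_one C (fun η => u η - v η) ?_ η hη
  intro η hη hpos
  have hns : ¬ StableOn U η := fun hs => (sub_pos.1 hpos).not_ge (h η hη hs)
  simp only [StableOn, not_forall, not_not] at hns
  obtain ⟨x, hxU, hx⟩ := hns
  refine ⟨x, hx, P.s, P.s_nonneg, P.s_lt_one, ?_, fun e _ => hC η hη x hxU hx e⟩
  rw [topple_sub, ← hu η hη x hxU hx, ← hv η hη x hxU hx]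

theorem eq_of_harmonicAt {P : Params} {U : Set ℤ} {C : Set (Config (segment N))}
    {u v : Config (segment N) → ℝ}
    (hC : ∀ η ∈ C, ∀ x : segment N, (x : ℤ) ∈ U → Act η x → ∀ e, applyEvent η (x, e) ∈ C)
    (hu : ∀ η ∈ C, HarmonicAt P U u η) (hv : ∀ η ∈ C, HarmonicAt P U v η)
    (h : ∀ η ∈ C, StableOn U η → u η = v η) : ∀ η ∈ C, u η = v η := fun η hη =>
  le_antisymm (le_of_harmonicAt hC hu hv (fun η hη hs => (h η hη hs).le) η hη)
    (le_of_harmonicAt hC hv hu (fun η hη hs => (h η hη hs).ge) η hη)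

/-- `x` is the leftmost active site of `U`. -/
def IsFirst (U : Set ℤ) {V : Finset ℤ} (η : Config V) (x : V) : Prop :=
  (x : ℤ) ∈ U ∧ Act η x ∧ ∀ y : V, (y : ℤ) ∈ U → Act η y → x ≤ y

theorem IsFirst.unique {U : Set ℤ} {V : Finset ℤ} {η : Config V} {x y : V} (hx : IsFirst U η x)
    (hy : IsFirst U η y) : x = y :=
  le_antisymm (hx.2.2 y hy.1 hy.2.1) (hy.2.2 x hx.1 hx.2.1)

theorem exists_isFirst {U : Set ℤ} {V : Finset ℤ} {η : Config V} {x : V} (hxU : (x : ℤ) ∈ U)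
    (hx : Act η x) : ∃ y, IsFirst U η y := by
  obtain ⟨y, hy⟩ := Set.Finite.exists_minimal
    (Set.toFinite {y : V | (y : ℤ) ∈ U ∧ Act η y}) ⟨x, hxU, hx⟩
  exact ⟨y, hy.1.1, hy.1.2, fun z hzU hz =>
    (le_total y z).elim id fun h => hy.2 ⟨hzU, hz⟩ h⟩

/-- A toppling at `x` can activate only neighbours of `x`, and `x` lies to the right of `y`. This
stability is the reason for toppling the leftmost site. -/
theorem IsFirst.applyEvent {U : Set ℤ} {V : Finset ℤ} {η : Config V} {x y : V}
    (hy : IsFirst U η y) (hxU : (x : ℤ) ∈ U) (hx : Act η x) (hxy : x ≠ y) (e : Event) :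
    IsFirst U (applyEvent η (x, e)) y := by
  refine ⟨hy.1, hy.2.1.applyEvent hxy.symm e, fun z hzU hz => ?_⟩
  have hlt : (y : ℤ) < x := lt_of_le_of_ne (hy.2.2 x hxU hx) fun h => hxy (Subtype.ext h.symm)
  change (y : ℤ) ≤ z
  rcases act_applyEvent_cases hz with h | h | h
  · exact hy.2.2 z hzU h
  · omega
  · omega

open Classical in
/-- One toppling of the leftmost active site of `U`, with payoff `g` if there is none. -/
noncomputable def firstStep (P : Params) (U : Set ℤ) (g u : Config (segment N) → ℝ)
    (η : Config (segment N)) : ℝ :=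
  if h : ∃ x, IsFirst U η x then topple P.s P.p h.choose u η else g η

theorem firstStep_of_isFirst {P : Params} {U : Set ℤ} (g u : Config (segment N) → ℝ)
    {η : Config (segment N)} {x : segment N} (hx : IsFirst U η x) :
    firstStep P U g u η = topple P.s P.p x u η := by
  have h : ∃ x, IsFirst U η x := ⟨x, hx⟩
  rw [firstStep, dif_pos h, h.choose_spec.unique hx]

theorem firstStep_of_stableOn {P : Params} {U : Set ℤ} (g u : Config (segment N) → ℝ)
    {η : Config (segment N)} (h : StableOn U η) : firstStep P U g u η = g η := by
  rw [firstStep, dif_neg]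
  rintro ⟨x, hx⟩
  exact h x hx.1 hx.2.1

theorem stableOn_or_exists_isFirst (U : Set ℤ) {V : Finset ℤ} (η : Config V) :
    StableOn U η ∨ ∃ x, IsFirst U η x := by
  by_cases h : StableOn U η
  · exact Or.inl h
  · simp only [StableOn, not_forall, not_not] at h
    obtain ⟨x, hxU, hx⟩ := h
    exact Or.inr (exists_isFirst hxU hx)

/-- Iteration from `0` increases because `0 ≤ g`. It is bounded by the sum of `g` over the finitely
many configurations with no more particles, a bound that does not increase under topplings. The
pointwise limit is a fixed point. -/
theorem exists_firstStep_fixedPoint_of_nonneg (P : Params) (U : Set ℤ)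
    (g : Config (segment N) → ℝ) (hg : ∀ η, 0 ≤ g η) : ∃ u, firstStep P U g u = u := by
  let a : ℕ → Config (segment N) → ℝ := fun k => (firstStep P U g)^[k] 0
  have ha : ∀ k, a (k + 1) = firstStep P U g (a k) := fun k =>
    Function.iterate_succ_apply' _ _ _
  have hmono' : ∀ u v : Config (segment N) → ℝ, u ≤ v → firstStep P U g u ≤ firstStep P U g v := by
    intro u v huv η
    rcases stableOn_or_exists_isFirst U η with h | ⟨x, hx⟩
    · rw [firstStep_of_stableOn _ _ h, firstStep_of_stableOn _ _ h]
    · rw [firstStep_of_isFirst _ _ hx, firstStep_of_isFirst _ _ hx]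
      exact P.topple_mono x fun e => huv _
  have hmono : ∀ k, a k ≤ a (k + 1) := by
    intro k
    induction k with
    | zero =>
      intro η
      rw [ha]
      rcases stableOn_or_exists_isFirst U η with h | ⟨x, hx⟩
      · rw [firstStep_of_stableOn _ _ h]; exact hg η
      · rw [firstStep_of_isFirst _ _ hx]
        exact (topple_const P.s P.p 0 x η).ge
    | succ k ih => rw [ha, ha (k + 1)]; exact hmono' _ _ ih
  let B : Config (segment N) → ℝ := fun η => ∑ ξ ∈ (finite_total_le (total η)).toFinset, g ξ
  have hB : ∀ k η, a k η ≤ B η := by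
    intro k
    induction k with
    | zero => exact fun η => Finset.sum_nonneg fun ξ _ => hg ξ
    | succ k ih =>
      intro η
      rw [ha]
      rcases stableOn_or_exists_isFirst U η with h | ⟨x, hx⟩
      · rw [firstStep_of_stableOn _ _ h]
        exact Finset.single_le_sum (f := g) (fun ξ _ => hg ξ) (by simp)
      · rw [firstStep_of_isFirst _ _ hx, ← topple_const P.s P.p (B η) x η]
        refine P.topple_mono x fun e => (ih _).trans ?_
        refine Finset.sum_le_sum_of_subset_of_nonneg (fun ξ hξ => ?_) fun ξ _ _ => hg ξ
        rw [Set.Finite.mem_toFinset] at hξ ⊢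
        exact le_trans (show total ξ ≤ _ from hξ) (total_applyEvent_le hx.2.1 e)
  have hmono_nat : ∀ η, Monotone fun k => a k η := fun η =>
    monotone_nat_of_le_succ fun k => hmono k η
  have hlim : ∀ η, Tendsto (fun k => a k η) atTop (𝓝 (⨆ k, a k η)) := fun η =>
    tendsto_atTop_ciSup (hmono_nat η) ⟨B η, by rintro _ ⟨k, rfl⟩; exact hB k η⟩
  refine ⟨fun η => ⨆ k, a k η, funext fun η => ?_⟩
  refine tendsto_nhds_unique ?_ ((tendsto_add_atTop_iff_nat 1).2 (hlim η))
  simp only [ha]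
  rcases stableOn_or_exists_isFirst U η with h | ⟨x, hx⟩
  · simp only [firstStep_of_stableOn _ _ h]
    exact tendsto_const_nhds
  · simp only [firstStep_of_isFirst _ _ hx, topple, jumpAvg]
    exact ((hlim _).const_mul _).add ((((hlim _).const_mul _).add
      ((hlim _).const_mul _)).const_mul _)

theorem exists_firstStep_fixedPoint (P : Params) (U : Set ℤ) (g : Config (segment N) → ℝ) :
    ∃ u, firstStep P U g u = u := by
  obtain ⟨u, hu⟩ := exists_firstStep_fixedPoint_of_nonneg P U (fun η => max (g η) 0)
    fun η => le_max_right _ _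
  obtain ⟨v, hv⟩ := exists_firstStep_fixedPoint_of_nonneg P U (fun η => max (-g η) 0)
    fun η => le_max_right _ _
  refine ⟨fun η => u η - v η, funext fun η => ?_⟩
  have hu := congrFun hu η
  have hv := congrFun hv η
  rcases stableOn_or_exists_isFirst U η with h | ⟨x, hx⟩
  · rw [firstStep_of_stableOn _ _ h] at hu hv ⊢
    rw [← hu, ← hv]
    rcases le_total 0 (g η) with h | h <;> simp [h]
  · rw [firstStep_of_isFirst _ _ hx] at hu hv ⊢
    rw [topple_sub, hu, hv]

/-- Abelian property: a function that is preserved by the topplings of the leftmost active site is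
preserved by all topplings. -/
theorem harmonicAt_of_firstStep_fixedPoint {P : Params} {U : Set ℤ}
    {g u : Config (segment N) → ℝ} (hu : firstStep P U g u = u) (η : Config (segment N)) :
    HarmonicAt P U u η := by
  intro x hxU hx
  have hfirst : ∀ η y, IsFirst U η y → u η = topple P.s P.p y u η := fun η y hy => by
    conv_lhs => rw [← hu]
    exact firstStep_of_isFirst _ _ hy
  -- Topplings of `x` and of the leftmost site `y ≠ x` commute, and `y` is still leftmost after the
  -- one of `x`. So `u - topple x u` equals its mean over a toppling of `y`. Meanwhile `x` stays
  -- active, and when `x` itself is leftmost the difference is zero.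
  have key : ∀ η, Act η x → ∃ y, Act η y ∧ (u η = topple P.s P.p x u η ∨
      y ≠ x ∧ u η - topple P.s P.p x u η
        = topple P.s P.p y (fun η => u η - topple P.s P.p x u η) η) := by
    intro η hx
    obtain ⟨y, hy⟩ := exists_isFirst hxU hx
    refine ⟨y, hy.2.1, ?_⟩
    by_cases hxy : x = y
    · exact Or.inl (hxy ▸ hfirst η y hy)
    · refine Or.inr ⟨Ne.symm hxy, ?_⟩
      rw [topple_sub, ← topple_comm _ _ hxy u hx hy.2.1, ← hfirst η y hy]
      congr 1
      simp only [topple, jumpAvg]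
      simp only [hfirst _ y (hy.applyEvent hxU hx hxy _), topple, jumpAvg]
  refine le_antisymm (sub_nonpos.1 ?_) (sub_nonpos.1 ?_)
  · refine max_principle P.p_pos P.p_lt_one {η | Act η x}
      (fun η => u η - topple P.s P.p x u η) ?_ η hx
    intro η hx hpos
    obtain ⟨y, hy, h | ⟨hyx, h⟩⟩ := key η hx
    · exact absurd h (sub_pos.1 hpos).ne'
    · exact ⟨y, hy, P.s, P.s_nonneg, P.s_lt_one, h.le, fun e _ => Act.applyEvent hyx.symm hx e⟩
  · refine max_principle P.p_pos P.p_lt_one {η | Act η x}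
      (fun η => topple P.s P.p x u η - u η) ?_ η hx
    intro η hx hpos
    obtain ⟨y, hy, h | ⟨hyx, h⟩⟩ := key η hx
    · exact absurd h (sub_pos.1 hpos).ne
    · refine ⟨y, hy, P.s, P.s_nonneg, P.s_lt_one, ?_, fun e _ => Act.applyEvent hyx.symm hx e⟩
      rw [topple_sub] at h ⊢
      linarith

/-- The mean of the payoff `g` after the stabilisation of the sites of `U`. -/
noncomputable def value (P : Params) (U : Set ℤ) (g : Config (segment N) → ℝ) :
    Config (segment N) → ℝ :=
  (exists_firstStep_fixedPoint P U g).choose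

section value

variable {P : Params} {U : Set ℤ} {g : Config (segment N) → ℝ}

theorem harmonicAt_value (P : Params) (U : Set ℤ) (g : Config (segment N) → ℝ)
    (η : Config (segment N)) : HarmonicAt P U (value P U g) η :=
  harmonicAt_of_firstStep_fixedPoint (exists_firstStep_fixedPoint P U g).choose_spec η

theorem value_of_stableOn {η : Config (segment N)} (h : StableOn U η) : value P U g η = g η := by
  have := congrFun (exists_firstStep_fixedPoint P U g).choose_spec η
  rw [firstStep_of_stableOn _ _ h] at this
  exact this.symm

theorem HarmonicAt.sub {u v : Config (segment N) → ℝ} {η : Config (segment N)}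
    (hu : HarmonicAt P U u η) (hv : HarmonicAt P U v η) :
    HarmonicAt P U (fun η => u η - v η) η := by
  intro x hxU hx
  rw [topple_sub, ← hu x hxU hx, ← hv x hxU hx]

theorem HarmonicAt.add {u v : Config (segment N) → ℝ} {η : Config (segment N)}
    (hu : HarmonicAt P U u η) (hv : HarmonicAt P U v η) :
    HarmonicAt P U (fun η => u η + v η) η := by
  intro x hxU hx
  rw [topple_add, ← hu x hxU hx, ← hv x hxU hx]

theorem HarmonicAt.const_mul {u : Config (segment N) → ℝ} {η : Config (segment N)}
    (hu : HarmonicAt P U u η) (a : ℝ) : HarmonicAt P U (fun η => a * u η) η := by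
  intro x hxU hx
  rw [topple_const_mul, ← hu x hxU hx]

theorem HarmonicAt.sum {ι : Type*} {I : Finset ι} {u : ι → Config (segment N) → ℝ}
    {η : Config (segment N)} (hu : ∀ i ∈ I, HarmonicAt P U (u i) η) :
    HarmonicAt P U (fun η => ∑ i ∈ I, u i η) η := by
  intro x hxU hx
  rw [topple_sum]
  exact Finset.sum_congr rfl fun i hi => hu i hi x hxU hx

theorem harmonicAt_const (a : ℝ) (η : Config (segment N)) : HarmonicAt P U (fun _ => a) η :=
  fun x _ _ => (topple_const _ _ _ x η).symm

theorem HarmonicAt.mono {U' : Set ℤ} {u : Config (segment N) → ℝ} {η : Config (segment N)}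
    (hu : HarmonicAt P U u η) (h : U' ⊆ U) : HarmonicAt P U' u η :=
  fun x hx => hu x (h hx)

theorem value_unique {u : Config (segment N) → ℝ} (hu : ∀ η, HarmonicAt P U u η)
    (h : ∀ η, StableOn U η → u η = g η) : u = value P U g :=
  funext fun η => eq_of_harmonicAt (C := Set.univ) (fun _ _ _ _ _ _ => trivial)
    (fun η _ => hu η) (fun η _ => harmonicAt_value P U g η)
    (fun η _ hs => (h η hs).trans (value_of_stableOn hs).symm) η trivial

theorem value_mono {g' : Config (segment N) → ℝ} (h : ∀ η, StableOn U η → g η ≤ g' η)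
    (η : Config (segment N)) : value P U g η ≤ value P U g' η :=
  le_of_harmonicAt (C := Set.univ) (fun _ _ _ _ _ _ => trivial)
    (fun η _ => harmonicAt_value P U g η) (fun η _ => harmonicAt_value P U g' η)
    (fun η _ hs => by rw [value_of_stableOn hs, value_of_stableOn hs]; exact h η hs) η trivial

theorem value_const (a : ℝ) : value P U (fun _ : Config (segment N) => a) = fun _ => a :=
  (value_unique (harmonicAt_const a) fun _ _ => rfl).symm

theorem value_sum {ι : Type*} (I : Finset ι) (a : ι → ℝ) (f : ι → Config (segment N) → ℝ)
    (η : Config (segment N)) :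
    value P U (fun ξ => ∑ i ∈ I, a i * f i ξ) η = ∑ i ∈ I, a i * value P U (f i) η :=
  (congrFun (value_unique (u := fun η => ∑ i ∈ I, a i * value P U (f i) η)
    (fun η => HarmonicAt.sum fun i _ => (harmonicAt_value P U (f i) η).const_mul (a i))
    fun η hs => by simp only [value_of_stableOn hs]) η).symm

theorem HarmonicAt.comp_addParticle {u : Config (segment N) → ℝ}
    (hu : ∀ η, HarmonicAt P U u η) (y : ℤ) (η : Config (segment N)) :
    HarmonicAt P U (fun η => u (addParticle η y)) η := by
  intro x hxU hx
  dsimp only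
  rw [hu _ x hxU (hx.addParticle y)]
  exact topple_congr _ _ _ fun e => by rw [applyEvent_addParticle hx]

theorem HarmonicAt.comp_applyEvent {u : Config (segment N) → ℝ}
    (hu : ∀ η, HarmonicAt P U u η) {c : segment N} (hcU : (c : ℤ) ∉ U) (f : Event)
    {η : Config (segment N)} (hc : Act η c) :
    HarmonicAt P U (fun η => u (applyEvent η (c, f))) η := by
  intro x hxU hx
  have hxc : x ≠ c := by rintro rfl; exact hcU hxU
  dsimp only
  rw [hu _ x hxU (hx.applyEvent hxc f)]
  exact topple_congr _ _ _ fun e => by rw [applyEvent_comm hxc hx hc]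

/-- Arrivals commute with topplings of active sites, so a particle may come after a first
stabilisation as well as before it. -/
theorem value_comp_addParticle (g : Config (segment N) → ℝ) (y : ℤ) (η : Config (segment N)) :
    value P U (fun ξ => value P U g (addParticle ξ y)) η = value P U g (addParticle η y) :=
  (congrFun (value_unique (u := fun η => value P U g (addParticle η y))
    (fun η => HarmonicAt.comp_addParticle (harmonicAt_value P U g) y η) fun _ _ => rfl) η).symm

/-- A sleep attempt among two or more particles is void, and it cancels from the mean since `s < 1`.
-/
theorem eq_jumpAvg_of_two_le {u : Config (segment N) → ℝ} {η : Config (segment N)}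
    (hu : HarmonicAt P U u η) {x : segment N} (hxU : (x : ℤ) ∈ U) (h : 2 ≤ (η x).numActive) :
    u η = jumpAvg P.p x u η := by
  have h1 := hu x hxU (lt_of_lt_of_le two_pos h)
  have h2 : applyEvent η (x, .sleep) = η := by
    simp [applyEvent, SiteState.fallAsleep_of_two_le h]
  unfold topple at h1
  rw [h2] at h1
  have h3 : (1 - P.s) * (u η - jumpAvg P.p x u η) = 0 := by linarith
  have := P.s_lt_one
  rcases mul_eq_zero.1 h3 with h | h <;> linarith

end value

end Value

/-! ### Effect of waking or adding a particle -/

section Monotonicity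

variable {N : ℕ}

open Classical in
/-- The number of particles in `U`. -/
noncomputable def mass (U : Set ℤ) {V : Finset ℤ} (η : Config V) : ℕ :=
  weight (fun z => if z ∈ U then 1 else 0) η

theorem mass_applyEvent_le {U : Set ℤ} {V : Finset ℤ} {η : Config V} {x : V} (hxU : (x : ℤ) ∈ U)
    (hx : Act η x) (e : Event) : mass U (applyEvent η (x, e)) ≤ mass U η := by
  refine weight_applyEvent_le _ hx e ?_ ?_ <;> rw [if_pos hxU] <;> split_ifs <;> simp

/-- The indicator of having at least `t` particles in `U`. -/
noncomputable def atLeast (U : Set ℤ) (t : ℕ) {V : Finset ℤ} (η : Config V) : ℝ :=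
  if t ≤ mass U η then 1 else 0

/-- Topplings in `U` never increase the number of particles in `U`. -/
theorem value_atLeast_le (P : Params) (U : Set ℤ) (t : ℕ) (η : Config (segment N)) :
    value P U (atLeast U t) η ≤ atLeast U t η := by
  by_cases h : t ≤ mass U η
  · have h1 := value_mono (P := P) (U := U) (g := atLeast U t) (g' := fun _ => 1)
      (fun η _ => by unfold atLeast; split_ifs <;> simp) η
    rw [value_const] at h1
    rwa [atLeast, if_pos h]
  · rw [atLeast, if_neg h]
    refine le_of_harmonicAt (C := {η | mass U η < t}) (v := fun _ => 0) ?_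
      (fun η _ => harmonicAt_value P U _ η) (fun η _ => harmonicAt_const 0 η) ?_ η (not_le.1 h)
    · exact fun η hη x hxU hx e => lt_of_le_of_lt (mass_applyEvent_le hxU hx e) hη
    · intro η hη hs
      rw [value_of_stableOn hs, atLeast, if_neg (not_le.2 hη)]

/-- A sleeping particle wakes up. -/
def SiteState.wake : SiteState → SiteState
  | active k => active k
  | sleeping => active 1

/-- A sleeping particle at `z`, if there is one, wakes up. -/
def wakeAt {V : Finset ℤ} (η : Config V) (z : V) : Config V :=
  Function.update η z (η z).wake

theorem applyEvent_wakeAt {V : Finset ℤ} (η : Config V) {x z : V} (hxz : x ≠ z) (e : Event) :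
    applyEvent (wakeAt η z) (x, e) = wakeAt (applyEvent η (x, e)) z := by
  funext y
  have h' : (z : ℤ) ≠ x := fun h' => hxz (Subtype.ext h'.symm)
  by_cases hy : y = z
  · subst hy
    have : (η y).wake.receive = (η y).receive.wake := by
      rcases η y with k | _ <;> rfl
    simp only [applyEvent_apply, wakeAt, Function.update_self]
    cases e <;> simp only [localEffect, h', if_false] <;> (try split_ifs) <;> first | rfl | exact this
  · simp [applyEvent_apply, wakeAt, hy]

theorem mass_wakeAt (U : Set ℤ) {V : Finset ℤ} (η : Config V) (z : V) :
    mass U (wakeAt η z) = mass U η := by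
  have := weight_update_add (fun z => open Classical in if z ∈ U then 1 else 0) η z (η z).wake 0
    (by rcases η z with k | _ <;> rfl)
  simpa [mass, wakeAt] using this

theorem wakeAt_of_ne_sleeping {V : Finset ℤ} {η : Config V} {z : V} (h : η z ≠ .sleeping) :
    wakeAt η z = η := by
  unfold wakeAt
  rw [Function.update_eq_self_iff]
  rcases h' : η z with k | _
  · rfl
  · exact absurd h' h

/-- Waking up a particle cannot increase the probability that many particles stay. -/
theorem value_atLeast_wakeAt_le (P : Params) (U : Set ℤ) (t : ℕ) (z : segment N)
    (η : Config (segment N)) :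
    value P U (atLeast U t) (wakeAt η z) ≤ value P U (atLeast U t) η := by
  rw [← sub_nonpos]
  refine max_principle P.p_pos P.p_lt_one Set.univ
    (fun η => value P U (atLeast U t) (wakeAt η z) - value P U (atLeast U t) η) ?_ η trivial
  intro η _ hpos
  -- While the particle at `z` sleeps, the active sites are other ones, and their topplings commute
  -- with waking it. Once it is awake the difference vanishes. If it sleeps and `U` is stable, the
  -- count is final, and a wake-up can only lose particles.
  have hz : η z = .sleeping := by
    by_contra h
    rw [wakeAt_of_ne_sleeping h, sub_self] at hpos
    exact lt_irrefl _ hpos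
  by_cases hs : StableOn U η
  · have h1 := value_atLeast_le P U t (wakeAt η z)
    rw [value_of_stableOn hs, sub_pos] at hpos
    rw [atLeast, mass_wakeAt, ← atLeast] at h1
    exact absurd hpos h1.not_gt
  · simp only [StableOn, not_forall, not_not] at hs
    obtain ⟨x, hxU, hx⟩ := hs
    have hxz : x ≠ z := by
      rintro rfl
      simp [Act, hz, SiteState.numActive] at hx
    have hx' : Act (wakeAt η z) x := by
      simpa [Act, wakeAt, hxz] using hx
    refine ⟨x, hx, P.s, P.s_nonneg, P.s_lt_one, ?_, fun e _ => trivial⟩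
    rw [topple_sub, ← harmonicAt_value P U _ η x hxU hx, harmonicAt_value P U _ _ x hxU hx']
    refine le_of_eq (congrArg (· - _) (topple_congr _ _ _ fun e => ?_))
    rw [applyEvent_wakeAt _ hxz]

/-- Minimum principle on an interval of integers. -/
theorem le_of_superharmonic {p : ℝ} (hp0 : 0 < p) (hp1 : p < 1) {f : ℤ → ℝ} {a b : ℤ} {m : ℝ}
    (h : ∀ z, a < z → z < b → p * f (z - 1) + (1 - p) * f (z + 1) ≤ f z)
    (ha : m ≤ f a) (hb : m ≤ f b) {z : ℤ} (hz : z ∈ Set.Icc a b) : m ≤ f z := by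
  rw [← sub_nonpos]
  refine nonpos_of_maximizer_descends (Set.finite_Icc a b) (fun z => m - f z)
    (fun z => (z - a).toNat) ?_ z hz
  intro z hz hpos hmax
  have hza : z ≠ a := by rintro rfl; linarith
  have hzb : z ≠ b := by rintro rfl; linarith
  have h1 : a < z := lt_of_le_of_ne hz.1 hza.symm
  have h2 : z < b := lt_of_le_of_ne hz.2 hzb
  have hl : z - 1 ∈ Set.Icc a b := ⟨by omega, by omega⟩
  have hr : z + 1 ∈ Set.Icc a b := ⟨by omega, by omega⟩
  refine ⟨z - 1, hl, by omega, ?_⟩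
  have h3 := h z h1 h2
  have h4 := hmax _ hr
  by_contra! hlt
  have h5 : p * f z < p * f (z - 1) := mul_lt_mul_of_pos_left (by linarith) hp0
  have h6 : (1 - p) * f z ≤ (1 - p) * f (z + 1) :=
    mul_le_mul_of_nonneg_left (by linarith) (by linarith)
  linarith

/-- An added particle that jumps at once might as well have been added at its target. A sleeping
particle at `z` is excluded because the arrival would wake it. -/
theorem jump_addParticle_self {V : Finset ℤ} {η : Config V} {z : V} (h : η z ≠ .sleeping) (y : ℤ) :
    jump (addParticle η z) z y = addParticle η y := by
  unfold jump
  congr 1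
  funext w
  by_cases hw : w = z
  · subst hw
    rcases h' : η w with k | _
    · simp [addParticle, h', SiteState.receive, SiteState.release]
    · exact absurd h' h
  · have h' : (w : ℤ) ≠ z := fun h' => hw (Subtype.ext h')
    simp [addParticle, hw, h']

theorem jumpAvg_addParticle_self {V : Finset ℤ} {η : Config V} {z : V} (h : η z ≠ .sleeping)
    (p : ℝ) (u : Config V → ℝ) : jumpAvg p z u (addParticle η z)
      = p * u (addParticle η (z - 1)) + (1 - p) * u (addParticle η (z + 1)) := by
  simp only [jumpAvg, applyEvent, jump_addParticle_self h]

theorem Act.ne_sleeping {V : Finset ℤ} {η : Config V} {x : V} (h : Act η x) :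
    η x ≠ .sleeping := by
  intro h'
  simp [Act, h', SiteState.numActive] at h

theorem two_le_numActive_addParticle {V : Finset ℤ} {η : Config V} {x : V} (h : Act η x) :
    2 ≤ (addParticle η x x).numActive := by
  unfold Act at h
  rcases h' : η x with k | _
  · simp only [h', SiteState.numActive] at h
    simp only [addParticle, h', SiteState.receive, SiteState.numActive, if_true]
    omega
  · exact absurd h' (Act.ne_sleeping h)

theorem value_addParticle_of_act {P : Params} {U : Set ℤ} (g : Config (segment N) → ℝ)
    {η : Config (segment N)} {z : segment N} (hzU : (z : ℤ) ∈ U) (hz : Act η z) :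
    value P U g (addParticle η z) = P.p * value P U g (addParticle η (z - 1))
      + (1 - P.p) * value P U g (addParticle η (z + 1)) := by
  rw [← jumpAvg_addParticle_self hz.ne_sleeping,
    eq_jumpAvg_of_two_le (harmonicAt_value P U g _) hzU (two_le_numActive_addParticle hz)]

/-- At an active site the added particle cannot sleep, and equality holds. At an empty site the
sleep outcome is at least as good as the particle staying awake, so the jumps are at most as good.
-/
theorem value_atLeast_addParticle_superharmonic {P : Params} {U : Set ℤ} (t : ℕ)
    {η : Config (segment N)} {z : segment N} (hzU : (z : ℤ) ∈ U) (hz : η z ≠ .sleeping) :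
    P.p * value P U (atLeast U t) (addParticle η (z - 1))
      + (1 - P.p) * value P U (atLeast U t) (addParticle η (z + 1))
      ≤ value P U (atLeast U t) (addParticle η z) := by
  by_cases hact : Act η z
  · exact (value_addParticle_of_act _ hzU hact).ge
  · have h0 : η z = .active 0 := by
      rcases h' : η z with (_ | k) | _
      · rfl
      · simp [Act, h', SiteState.numActive] at hact
      · exact absurd h' hz
    have h1 := harmonicAt_value P U (atLeast U t) _ z hzU (act_addParticle_self η z)
    have h2 : wakeAt (applyEvent (addParticle η z) (z, .sleep)) z = addParticle η z := by
      funext w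
      by_cases hw : w = z
      · subst hw
        simp [wakeAt, applyEvent, addParticle, h0, SiteState.receive, SiteState.fallAsleep,
          SiteState.wake]
      · simp [wakeAt, applyEvent, hw]
    have h3 := value_atLeast_wakeAt_le P U t z (applyEvent (addParticle η z) (z, .sleep))
    rw [h2] at h3
    rw [topple, jumpAvg_addParticle_self hz] at h1
    have h4 := mul_le_mul_of_nonneg_left h3 P.s_nonneg
    have h5 := P.s_lt_one
    refine le_of_mul_le_mul_left ?_ (sub_pos.2 h5)
    linarith

/-- Adding a particle in an interval without sleeping particles does not decrease the probability
that many particles stay, if it does not decrease when the particle is added at the ends. -/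
theorem value_atLeast_le_addParticle {P : Params} {U : Set ℤ} (t : ℕ) {η : Config (segment N)}
    {a b : ℤ} (hU : ∀ z, a < z → z < b → z ∈ segment N ∧ z ∈ U)
    (hη : ∀ z : segment N, a < z → (z : ℤ) < b → η z ≠ .sleeping)
    (ha : value P U (atLeast U t) η ≤ value P U (atLeast U t) (addParticle η a))
    (hb : value P U (atLeast U t) η ≤ value P U (atLeast U t) (addParticle η b))
    {z : ℤ} (hz : z ∈ Set.Icc a b) :
    value P U (atLeast U t) η ≤ value P U (atLeast U t) (addParticle η z) := by
  refine le_of_superharmonic (f := fun z => value P U (atLeast U t) (addParticle η z))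
    P.p_pos P.p_lt_one ?_ ha hb hz
  intro z h1 h2
  exact value_atLeast_addParticle_superharmonic (z := ⟨z, (hU z h1 h2).1⟩) t (hU z h1 h2).2
    (hη _ h1 h2)

/-- The value after an arrival at `z` is harmonic in `z` on the segment. Arrivals at `0` and `N + 1`
are killed, so both boundary values are the value without arrival, and the minimum principle applies
to both signs. -/
theorem value_addParticle_of_forall_act {P : Params} (g : Config (segment N) → ℝ)
    {η : Config (segment N)} (hη : ∀ x, Act η x) (z : ℤ) :
    value P Set.univ g (addParticle η z) = value P Set.univ g η := by
  by_cases hz : z ∈ segment N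
  swap
  · rw [addParticle_of_notMem _ hz]
  have h0 : (0 : ℤ) ∉ segment N := by simp [segment]
  have hN : (N + 1 : ℤ) ∉ segment N := by simp [segment]
  have hmem : z ∈ Set.Icc (0 : ℤ) (N + 1) := by
    have := Finset.mem_Icc.1 hz
    exact ⟨by omega, by omega⟩
  have hmean : ∀ z : ℤ, 0 < z → z < N + 1 → value P Set.univ g (addParticle η z) =
      P.p * value P Set.univ g (addParticle η (z - 1))
      + (1 - P.p) * value P Set.univ g (addParticle η (z + 1)) := fun z h1 h2 =>
    value_addParticle_of_act (z := ⟨z, Finset.mem_Icc.2 ⟨by omega, by omega⟩⟩) g trivial (hη _)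
  refine le_antisymm (neg_le_neg_iff.1 ?_) ?_
  · refine le_of_superharmonic (f := fun z => -value P Set.univ g (addParticle η z))
      P.p_pos P.p_lt_one ?_ ?_ ?_ hmem
    · intro z h1 h2
      have := hmean z h1 h2
      linarith
    · rw [addParticle_of_notMem _ h0]
    · rw [addParticle_of_notMem _ hN]
  · refine le_of_superharmonic (f := fun z => value P Set.univ g (addParticle η z))
      P.p_pos P.p_lt_one ?_ ?_ ?_ hmem
    · exact fun z h1 h2 => (hmean z h1 h2).ge
    · rw [addParticle_of_notMem _ h0]
    · rw [addParticle_of_notMem _ hN]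

/-- The configuration with one active particle at each site. -/
def full (V : Finset ℤ) : Config V := fun _ => .active 1

theorem act_full {V : Finset ℤ} (x : V) : Act (full V) x := Nat.one_pos

/-- If each site contains an active particle, then the law of the stable configuration that is
reached does not depend on the numbers of particles. -/
theorem value_of_forall_act {P : Params} (g : Config (segment N) → ℝ) :
    ∀ (η : Config (segment N)), (∀ x, Act η x) →
      value P Set.univ g η = value P Set.univ g (full _) := by
  suffices ∀ k, ∀ η : Config (segment N), total η = k → (∀ x, Act η x) →
      value P Set.univ g η = value P Set.univ g (full _) from fun η => this _ η rfl
  intro k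
  induction k using Nat.strong_induction_on with
  | _ k ih =>
    intro η hk hη
    by_cases h : ∀ x, (η x).numActive = 1
    · congr 1
      funext x
      have := h x
      rcases h' : η x with j | _
      · simp only [h', SiteState.numActive] at this
        rw [this, full]
      · exact absurd h' (hη x).ne_sleeping
    · push Not at h
      obtain ⟨x, hx⟩ := h
      have h2 : 2 ≤ (η x).numActive := by
        have : 0 < (η x).numActive := hη x
        omega
      have hadd : addParticle (Function.update η x (η x).release) x = η := by
        funext z
        by_cases hz : z = x
        · subst hz
          rcases h' : η z with j | _
          · simp only [h', SiteState.numActive] at h2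
            simp only [addParticle, Function.update_self, SiteState.release, if_true,
              SiteState.receive, SiteState.active.injEq]
            omega
          · exact absurd h' (hη z).ne_sleeping
        · have h' : (z : ℤ) ≠ x := fun h' => hz (Subtype.ext h')
          simp [addParticle, hz, h']
      have htot := weight_update_add (fun _ => 1) η x (η x).release 1
        (SiteState.count_release (hη x))
      have hact : ∀ z, Act (Function.update η x (η x).release) z := by
        intro z
        by_cases hz : z = x
        · subst hz
          rcases h' : η z with j | _
          · simp only [h', SiteState.numActive] at h2
            simp only [Act, Function.update_self, SiteState.release, SiteState.numActive]
            omega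
          · exact absurd h' (hη z).ne_sleeping
        · simpa [Act, hz] using hη z
      rw [← hadd, value_addParticle_of_forall_act g hact]
      refine ih _ ?_ _ rfl hact
      unfold total at hk ⊢
      omega

end Monotonicity

/-! ### From the continuous-time dynamics to topplings -/

section Dynamics

variable {N : ℕ}

/-- The parameters of the topplings for the continuous-time dynamics. -/
noncomputable def Params.ofRates (lam p : ℝ) (hlam : 0 < lam) (hp0 : 0 < p) (hp1 : p < 1) :
    Params where
  -- A lone active particle has total rate `1 + lam`, of which `lam` is for sleep.
  s := lam / (1 + lam)
  p := p
  s_nonneg := by positivity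
  s_lt_one := by rw [div_lt_one (by positivity)]; linarith
  p_pos := hp0
  p_lt_one := hp1

theorem isStable_iff {V : Finset ℤ} {η : Config V} : IsStable η ↔ StableOn Set.univ η := by
  simp [IsStable, StableOn, Act]

section step

variable {lam p : ℝ} {V : Finset ℤ} {η : Config V}

theorem rate_of_not_act {x : V} (hx : ¬ Act η x) (e : Event) : rate lam p η (x, e) = 0 := by
  have h : (η x).numActive = 0 := by simpa [Act] using hx
  cases e
  · simp [rate, h]
  · simp [rate, h]
  · rcases h' : η x with (_ | k) | _
    · simp [rate, h', SiteState.sleepRate]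
    · simp [h', SiteState.numActive] at h
    · simp [rate, h', SiteState.sleepRate]

theorem step_of_isStable (h : IsStable η) : step lam p η = PMF.pure η := by
  rw [step, dif_pos]
  rw [ENNReal.tsum_eq_zero]
  rintro ⟨x, e⟩
  exact rate_of_not_act (isStable_iff.1 h x trivial) e

theorem evolve_of_isStable (h : IsStable η) (k : ℕ) : evolve lam p η k = PMF.pure η := by
  induction k with
  | zero => rfl
  | succ k ih => rw [evolve, ih, PMF.pure_bind, step_of_isStable h]

/-- `evolve` appends steps at the end, whereas the mean value equation decomposes at the first step.
-/
theorem evolve_succ_eq_step_bind (η : Config V) (k : ℕ) :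
    evolve lam p η (k + 1) = (step lam p η).bind fun η' => evolve lam p η' k := by
  induction k generalizing η with
  | zero => simp [evolve]
  | succ k ih =>
    rw [evolve, ih, PMF.bind_bind]
    rfl

theorem evolve_apply_mono (η : Config V) (ξ : StableConfig V) :
    Monotone fun k => evolve lam p η k ξ.1 := by
  refine monotone_nat_of_le_succ fun k => ?_
  rw [evolve, PMF.bind_apply]
  refine le_trans ?_ (ENNReal.le_tsum ξ.1)
  rw [step_of_isStable ξ.2, PMF.pure_apply, if_pos rfl, mul_one]

theorem stabProb_le_one (η : Config V) (ξ : StableConfig V) : stabProb lam p η ξ ≤ 1 :=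
  iSup_le fun _ => PMF.coe_le_one _ _

theorem stabProb_of_isStable (h : IsStable η) (ξ : StableConfig V) :
    stabProb lam p η ξ = open Classical in if η = ξ.1 then 1 else 0 := by
  simp only [stabProb, evolve_of_isStable h, ciSup_const, PMF.pure_apply]
  congr 1
  exact propext eq_comm

theorem stabProb_eq_sum (h : ∑' e, rate lam p η e ≠ 0) (ξ : StableConfig V) :
    stabProb lam p η ξ = ∑ e, rate lam p η e * (∑' e, rate lam p η e)⁻¹ *
      stabProb lam p (applyEvent η e) ξ := by
  have h1 : stabProb lam p η ξ = ⨆ k, evolve lam p η (k + 1) ξ.1 :=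
    (Monotone.iSup_nat_add (evolve_apply_mono η ξ) 1).symm
  rw [h1]
  have h2 : ∀ k, evolve lam p η (k + 1) ξ.1 = ∑ e, rate lam p η e * (∑' e, rate lam p η e)⁻¹ *
      evolve lam p (applyEvent η e) k ξ.1 := by
    intro k
    rw [evolve_succ_eq_step_bind, step, dif_neg h, PMF.bind_map, PMF.bind_apply, tsum_fintype]
    rfl
  simp only [h2, stabProb, ENNReal.mul_iSup]
  rw [ENNReal.finsetSum_iSup_of_monotone]
  exact fun e => fun i j hij => mul_le_mul_right (evolve_apply_mono _ ξ hij) _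

/-- The next elementary event preserves the mean of `h`. -/
def IsStepMean (lam p : ℝ) (h : Config V → ℝ) : Prop :=
  ∀ η, (∑ e, (rate lam p η e).toReal) * h η
    = ∑ e, (rate lam p η e).toReal * h (applyEvent η e)

theorem isStepMean_stabProb (ξ : StableConfig V) :
    IsStepMean lam p fun η : Config V => (stabProb lam p η ξ).toReal := by
  intro η
  have htop : ∀ e, rate lam p η e ≠ ∞ := fun e => ne_top_of_le_ne_top
    (tsum_rate_ne_top lam p η) (ENNReal.le_tsum e)
  have hsum : (∑' e, rate lam p η e).toReal = ∑ e, (rate lam p η e).toReal := by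
    rw [tsum_fintype, ENNReal.toReal_sum fun e _ => htop e]
  by_cases h : ∑' e, rate lam p η e = 0
  · have h0 := ENNReal.tsum_eq_zero.1 h
    simp [h0]
  · have hne : ∑ e, (rate lam p η e).toReal ≠ 0 := by
      rw [← hsum]
      exact (ENNReal.toReal_pos h (tsum_rate_ne_top lam p η)).ne'
    dsimp only
    rw [stabProb_eq_sum h ξ, ENNReal.toReal_sum, Finset.mul_sum]
    · refine Finset.sum_congr rfl fun e _ => ?_
      rw [ENNReal.toReal_mul, ENNReal.toReal_mul, ENNReal.toReal_inv, hsum]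
      field_simp
    · exact fun e _ => ENNReal.mul_ne_top (ENNReal.mul_ne_top (htop e) (ENNReal.inv_ne_top.2 h))
        (ne_top_of_le_ne_top ENNReal.one_ne_top (stabProb_le_one _ _))

theorem sum_event (f : Event → ℝ) : ∑ e, f e = f .left + f .right + f .sleep := by
  change ∑ e ∈ {Event.left, Event.right, Event.sleep}, f e = _
  rw [Finset.sum_insert (by decide), Finset.sum_insert (by decide), Finset.sum_singleton, add_assoc]

/-- The next elementary event at a given active site is a toppling. -/
theorem exists_sum_rate_eq_topple (hlam : 0 < lam) (hp0 : 0 < p) (hp1 : p < 1) {x : V}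
    (hx : Act η x) : 0 < ∑ e, (rate lam p η (x, e)).toReal ∧ ∃ s, 0 ≤ s ∧ s < 1 ∧
      (s = lam / (1 + lam) ∨ 2 ≤ (η x).numActive ∧ s = 0) ∧
      ∀ w : Config V → ℝ, ∑ e, (rate lam p η (x, e)).toReal * w (applyEvent η (x, e))
        = (∑ e, (rate lam p η (x, e)).toReal) * topple s p x w η := by
  have hp1' : 0 < 1 - p := sub_pos.2 hp1
  have hL : (rate lam p η (x, .left)).toReal = (η x).numActive * p :=
    ENNReal.toReal_ofReal (by positivity)
  have hR : (rate lam p η (x, .right)).toReal = (η x).numActive * (1 - p) :=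
    ENNReal.toReal_ofReal (by positivity)
  rcases h : η x with (_ | _ | k) | _
  · simp [Act, h, SiteState.numActive] at hx
  · have hS : (rate lam p η (x, .sleep)).toReal = lam := by
      rw [rate, h]; exact ENNReal.toReal_ofReal hlam.le
    simp only [sum_event, hL, hR, hS]
    simp only [h, SiteState.numActive]
    push_cast
    refine ⟨by linarith, lam / (1 + lam), by positivity, ?_, Or.inl rfl, fun w => ?_⟩
    · rw [div_lt_one (by positivity)]; linarith
    · unfold topple jumpAvg
      field_simp
      ring
  · have hS : (rate lam p η (x, .sleep)).toReal = 0 := by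
      rw [rate, h]; simp [SiteState.sleepRate]
    simp only [sum_event, hL, hR, hS]
    simp only [h, SiteState.numActive]
    refine ⟨by push_cast; nlinarith, 0, le_rfl, one_pos, Or.inr ⟨by omega, rfl⟩, fun w => ?_⟩
    unfold topple jumpAvg
    ring
  · simp [Act, h, SiteState.numActive] at hx

end step

variable {lam p : ℝ}

/-- The next event mixes all active sites. If the mean inequality for the difference failed at every
one of them, it would fail for the sum weighted by rates. So it holds at some active site, which is
all that the maximum principle needs. -/
theorem le_of_isStepMean (hlam : 0 < lam) (hp0 : 0 < p) (hp1 : p < 1)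
    {u v : Config (segment N) → ℝ} (hu : IsStepMean lam p u) (hv : IsStepMean lam p v)
    (h : ∀ η, IsStable η → u η ≤ v η) (η : Config (segment N)) : u η ≤ v η := by
  rw [← sub_nonpos]
  refine max_principle hp0 hp1 Set.univ (fun η => u η - v η) ?_ η trivial
  intro η _ hpos
  have hns : ¬ StableOn Set.univ η := fun hs => (sub_pos.1 hpos).not_ge (h η (isStable_iff.2 hs))
  simp only [StableOn, not_forall, not_not] at hns
  obtain ⟨y, -, hy⟩ := hns
  by_contra hcon
  have hlt : ∀ x, Act η x → ∑ e, (rate lam p η (x, e)).toReal *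
      (u (applyEvent η (x, e)) - v (applyEvent η (x, e)))
      < (∑ e, (rate lam p η (x, e)).toReal) * (u η - v η) := by
    intro x hx
    obtain ⟨hA, s, hs0, hs1, -, hs⟩ := exists_sum_rate_eq_topple hlam hp0 hp1 hx
    rw [hs fun η => u η - v η]
    refine mul_lt_mul_of_pos_left (not_le.1 fun hle => hcon ?_) hA
    exact ⟨x, hx, s, hs0, hs1, hle, fun _ _ => trivial⟩
  have hsum : ∑ x : segment N, ∑ e, (rate lam p η (x, e)).toReal *
      (u (applyEvent η (x, e)) - v (applyEvent η (x, e)))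
      < ∑ x : segment N, (∑ e, (rate lam p η (x, e)).toReal) * (u η - v η) := by
    refine Finset.sum_lt_sum (fun x _ => ?_) ⟨y, Finset.mem_univ y, hlt y hy⟩
    by_cases hx : Act η x
    · exact (hlt x hx).le
    · simp [rate_of_not_act hx]
  have h1 := hu η
  have h2 := hv η
  simp only [Fintype.sum_prod_type] at h1 h2
  rw [← Finset.sum_mul] at hsum
  simp only [mul_sub, Finset.sum_sub_distrib] at hsum
  linarith

/-- The events at one site form a toppling, with sleep probability `0` instead of `s` if there are
two or more particles; there sleep attempts are void anyway. -/
theorem isStepMean_of_harmonicAt (hlam : 0 < lam) (hp0 : 0 < p) (hp1 : p < 1)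
    {u : Config (segment N) → ℝ}
    (hu : ∀ η, HarmonicAt (Params.ofRates lam p hlam hp0 hp1) Set.univ u η) :
    IsStepMean lam p u := by
  intro η
  simp only [Fintype.sum_prod_type, Finset.sum_mul]
  refine Finset.sum_congr rfl fun x _ => ?_
  by_cases hx : Act η x
  · obtain ⟨-, s, -, -, h, hs⟩ := exists_sum_rate_eq_topple hlam hp0 hp1 hx
    rw [hs u, ← Finset.sum_mul]
    congr 1
    rcases h with rfl | ⟨h, rfl⟩
    · exact hu η x trivial hx
    · rw [eq_jumpAvg_of_two_le (hu η) trivial h]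
      simp only [topple, Params.ofRates]
      ring
  · simp [rate_of_not_act hx]

open Classical in
/-- The indicator of a configuration. -/
noncomputable def single {V : Finset ℤ} (ξ η : Config V) : ℝ := if η = ξ then 1 else 0

theorem stabProb_eq_value (hlam : 0 < lam) (hp0 : 0 < p) (hp1 : p < 1) (η : Config (segment N))
    (ξ : StableConfig (segment N)) : stabProb lam p η ξ =
      ENNReal.ofReal (value (Params.ofRates lam p hlam hp0 hp1) Set.univ (single ξ.1) η) := by
  have h1 := isStepMean_stabProb (lam := lam) (p := p) ξ
  have h2 := isStepMean_of_harmonicAt hlam hp0 hp1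
    (harmonicAt_value (Params.ofRates lam p hlam hp0 hp1) Set.univ (single ξ.1))
  have h3 : ∀ η, IsStable η → (stabProb lam p η ξ).toReal =
      value (Params.ofRates lam p hlam hp0 hp1) Set.univ (single ξ.1) η := by
    intro η hη
    rw [stabProb_of_isStable hη, value_of_stableOn (isStable_iff.1 hη), single]
    split_ifs <;> simp
  rw [← le_antisymm (le_of_isStepMean hlam hp0 hp1 h1 h2 (fun η hη => (h3 η hη).le) η)
    (le_of_isStepMean hlam hp0 hp1 h2 h1 (fun η hη => (h3 η hη).ge) η),
    ENNReal.ofReal_toReal (ne_top_of_le_ne_top ENNReal.one_ne_top (stabProb_le_one _ _))]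

end Dynamics

/-! ### The unique stationary law is that of the stabilisation of `full` -/

section Stationarity

variable {N : ℕ}

instance {V : Finset ℤ} : Finite (StableConfig V) := by
  refine Set.Finite.to_subtype ((Set.Finite.pi' (t := fun _ : V => {SiteState.active 0,
    SiteState.sleeping}) fun _ => Set.toFinite _).subset ?_)
  intro η hη x
  have := hη x
  rcases h : η x with (_ | k) | _
  · simp
  · simp [h, SiteState.numActive] at this
  · simp

noncomputable instance {V : Finset ℤ} : Fintype (StableConfig V) := Fintype.ofFinite _

theorem sum_single {V : Finset ℤ} (g : Config V → ℝ) {η : Config V} (hη : IsStable η) :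
    ∑ ξ : StableConfig V, g ξ.1 * single ξ.1 η = g η := by
  rw [Finset.sum_eq_single ⟨η, hη⟩]
  · simp [single]
  · intro ξ _ h
    rw [single, if_neg, mul_zero]
    rintro rfl
    exact h rfl
  · simp

variable (P : Params)

theorem value_congr {P : Params} {U : Set ℤ} {g g' : Config (segment N) → ℝ}
    (h : ∀ η, StableOn U η → g η = g' η) : value P U g = value P U g' :=
  value_unique (harmonicAt_value P U g) fun η hs => (value_of_stableOn hs).trans (h η hs)

theorem sum_mul_value_single (g : Config (segment N) → ℝ) (η : Config (segment N)) :
    ∑ ξ : StableConfig (segment N), g ξ.1 * value P Set.univ (single ξ.1) η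
      = value P Set.univ g η := by
  rw [← value_sum]
  exact congrFun (value_congr fun η hη => sum_single g (isStable_iff.2 hη)) η

/-- The mean of `g` after one step of the driven-dissipative chain. -/
noncomputable def ddMean (g : Config (segment N) → ℝ) (η : Config (segment N)) : ℝ :=
  (N : ℝ)⁻¹ * ∑ x : segment N, value P Set.univ g (addParticle η x)

theorem card_segment (N : ℕ) : (segment N).card = N := by simp [segment]

theorem value_single_nonneg (ξ η : Config (segment N)) : 0 ≤ value P Set.univ (single ξ) η := by
  have := value_mono (P := P) (U := Set.univ) (g := fun _ => 0) (g' := single ξ)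
    (fun η _ => by unfold single; split_ifs <;> simp) η
  rwa [value_const] at this

theorem sum_mul_ddMean_single (g : Config (segment N) → ℝ) (η : Config (segment N)) :
    ∑ ξ : StableConfig (segment N), g ξ.1 * ddMean P (single ξ.1) η = ddMean P g η := by
  simp only [ddMean, ← sum_mul_value_single P g, Finset.mul_sum]
  rw [Finset.sum_comm]
  refine Finset.sum_congr rfl fun x _ => Finset.sum_congr rfl fun ξ _ => by ring

theorem ddProb_eq_ddMean {lam p : ℝ} (hN : 1 ≤ N) (hlam : 0 < lam) (hp0 : 0 < p) (hp1 : p < 1)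
    (η ξ : StableConfig (segment N)) : ddProb lam p η ξ =
      ENNReal.ofReal (ddMean (Params.ofRates lam p hlam hp0 hp1) (single ξ.1) η.1) := by
  have hN' : (0 : ℝ) < N := by exact_mod_cast hN
  simp only [ddProb, ddMean, card_segment, stabProb_eq_value hlam hp0 hp1]
  rw [← Finset.mul_sum, ← ENNReal.ofReal_sum_of_nonneg fun x _ => value_single_nonneg _ _ _,
    ENNReal.ofReal_mul (by positivity), ENNReal.ofReal_inv_of_pos hN', ENNReal.ofReal_natCast]

theorem ddMean_single_nonneg (ξ η : Config (segment N)) : 0 ≤ ddMean P (single ξ) η :=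
  mul_nonneg (by positivity) (Finset.sum_nonneg fun _ _ => value_single_nonneg _ _ _)

/-- `ν` is a stationary (signed) measure of the driven-dissipative chain. -/
def IsStationaryMass (ν : StableConfig (segment N) → ℝ) : Prop :=
  ∀ ξ : StableConfig (segment N),
    ∑ η : StableConfig (segment N), ν η * ddMean P (single ξ.1) η.1 = ν ξ

theorem isStationary_iff {lam p : ℝ} (hN : 1 ≤ N) (hlam : 0 < lam) (hp0 : 0 < p) (hp1 : p < 1)
    (π : PMF (StableConfig (segment N))) : IsStationary lam p π ↔
      IsStationaryMass (Params.ofRates lam p hlam hp0 hp1) fun ξ => (π ξ).toReal := by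
  have key : ∀ ξ, ∑' η, π η * ddProb lam p η ξ = ENNReal.ofReal (∑ η, (π η).toReal *
      ddMean (Params.ofRates lam p hlam hp0 hp1) (single ξ.1) η.1) := by
    intro ξ
    rw [tsum_fintype, ENNReal.ofReal_sum_of_nonneg fun η _ =>
      mul_nonneg ENNReal.toReal_nonneg (ddMean_single_nonneg _ _ _)]
    refine Finset.sum_congr rfl fun η _ => ?_
    rw [ENNReal.ofReal_mul ENNReal.toReal_nonneg, ENNReal.ofReal_toReal (π.apply_ne_top η),
      ddProb_eq_ddMean hN hlam hp0 hp1]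
  refine forall_congr' fun ξ => ?_
  rw [key, ← ENNReal.toReal_eq_toReal_iff' ENNReal.ofReal_ne_top (π.apply_ne_top ξ),
    ENNReal.toReal_ofReal (Finset.sum_nonneg fun η _ =>
      mul_nonneg ENNReal.toReal_nonneg (ddMean_single_nonneg _ _ _))]

/-- The law of the stable configuration that is reached from the configuration with one active
particle at each site. -/
noncomputable def fullMass (ξ : StableConfig (segment N)) : ℝ :=
  value P Set.univ (single ξ.1) (full (segment N))

theorem sum_fullMass_mul (g : Config (segment N) → ℝ) :
    ∑ ξ : StableConfig (segment N), fullMass P ξ * g ξ.1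
      = value P Set.univ g (full (segment N)) := by
  rw [← sum_mul_value_single]
  exact Finset.sum_congr rfl fun ξ _ => mul_comm _ _

theorem fullMass_nonneg (ξ : StableConfig (segment N)) : 0 ≤ fullMass P ξ :=
  value_single_nonneg _ _ _

theorem sum_fullMass : ∑ ξ : StableConfig (segment N), fullMass P ξ = 1 := by
  have := sum_fullMass_mul P (fun _ : Config (segment N) => 1)
  rw [value_const] at this
  simpa using this

/-- By the abelian property, one step of the chain after the stabilisation of `full` gives the
stabilisation of `full` with an extra particle, which has no effect. -/
theorem isStationaryMass_fullMass (hN : 1 ≤ N) :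
    IsStationaryMass P (fullMass P : StableConfig (segment N) → ℝ) := by
  intro ξ
  have hN' : (N : ℝ) ≠ 0 := by positivity
  rw [sum_fullMass_mul P fun η => ddMean P (single ξ.1) η]
  have h : (ddMean P (single ξ.1) : Config (segment N) → ℝ) = fun η => ∑ x : segment N,
      (N : ℝ)⁻¹ * value P Set.univ (single ξ.1) (addParticle η x) :=
    funext fun η => Finset.mul_sum _ _ _
  rw [h, value_sum _ (fun _ : segment N => (N : ℝ)⁻¹)
    fun x η => value P Set.univ (single ξ.1) (addParticle η x)]
  simp only [value_comp_addParticle, value_addParticle_of_forall_act _ act_full]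
  simp [card_segment, hN', fullMass]

theorem IsStationaryMass.sum_mul_ddMean {P : Params} {ν : StableConfig (segment N) → ℝ}
    (hν : IsStationaryMass P ν) (g : Config (segment N) → ℝ) :
    ∑ η : StableConfig (segment N), ν η * ddMean P g η.1 = ∑ ξ, ν ξ * g ξ.1 := by
  calc ∑ η : StableConfig (segment N), ν η * ddMean P g η.1
      = ∑ η : StableConfig (segment N), ∑ ξ : StableConfig (segment N),
          ν η * ddMean P (single ξ.1) η.1 * g ξ.1 := by
        refine Finset.sum_congr rfl fun η _ => ?_
        rw [← sum_mul_ddMean_single, Finset.mul_sum]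
        exact Finset.sum_congr rfl fun ξ _ => by ring
    _ = _ := by
        rw [Finset.sum_comm]
        refine Finset.sum_congr rfl fun ξ _ => ?_
        rw [← Finset.sum_mul, hν ξ]

/-- The chain picks the site `x` with probability `1 / N`, and the other sites contribute
nonnegative terms. -/
theorem IsStationaryMass.sum_mul_value_addParticle_le {P : Params} (hN : 1 ≤ N)
    {ν : StableConfig (segment N) → ℝ} (hν : IsStationaryMass P ν) (h0 : ∀ ξ, 0 ≤ ν ξ)
    {g : Config (segment N) → ℝ} (hg : ∀ η, 0 ≤ g η) (x : segment N) :
    ∑ η : StableConfig (segment N), ν η * value P Set.univ g (addParticle η.1 x)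
      ≤ N * ∑ ξ, ν ξ * g ξ.1 := by
  have hN' : (N : ℝ) ≠ 0 := by positivity
  rw [← hν.sum_mul_ddMean g, Finset.mul_sum]
  refine Finset.sum_le_sum fun η _ => ?_
  have hval : ∀ η, 0 ≤ value P Set.univ g η := fun η => by
    have := value_mono (P := P) (U := Set.univ) (g := fun _ => 0) (g' := g) (fun η _ => hg η) η
    rwa [value_const] at this
  have : (N : ℝ) * (ν η * ddMean P g η.1)
      = ν η * ∑ x : segment N, value P Set.univ g (addParticle η.1 x) := by
    unfold ddMean
    field_simp
  rw [this]
  exact mul_le_mul_of_nonneg_left (Finset.single_le_sum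
    (f := fun x : segment N => value P Set.univ g (addParticle η.1 x))
    (fun x _ => hval _) (Finset.mem_univ x)) (h0 η)

/-- Active particles arrive at the sites of a list. -/
def addParticles {V : Finset ℤ} (η : Config V) (l : List V) : Config V :=
  l.foldl (fun η (x : V) => addParticle η (x : ℤ)) η

theorem act_addParticles {V : Finset ℤ} {x : V} {l : List V} {η : Config V}
    (h : Act η x ∨ x ∈ l) : Act (addParticles η l) x := by
  induction l generalizing η with
  | nil => simpa [addParticles] using h
  | cons y l ih =>
    refine ih (η := addParticle η y) ?_
    rcases h with h | h
    · exact Or.inl (h.addParticle y)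
    · rcases List.mem_cons.1 h with rfl | h
      · exact Or.inl (act_addParticle_self η x)
      · exact Or.inr h

theorem harmonicAt_comp_addParticles {P : Params} {U : Set ℤ} {u : Config (segment N) → ℝ}
    (hu : ∀ η, HarmonicAt P U u η) (l : List (segment N)) (η : Config (segment N)) :
    HarmonicAt P U (fun η => u (addParticles η l)) η := by
  induction l generalizing η with
  | nil => exact hu η
  | cons y l ih => exact HarmonicAt.comp_addParticle ih y η

theorem IsStationaryMass.sum_mul_value_addParticles_le {P : Params} (hN : 1 ≤ N)
    {ν : StableConfig (segment N) → ℝ} (hν : IsStationaryMass P ν) (h0 : ∀ ξ, 0 ≤ ν ξ)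
    {g : Config (segment N) → ℝ} (hg : ∀ η, 0 ≤ g η) (l : List (segment N)) :
    ∑ η : StableConfig (segment N), ν η * value P Set.univ g (addParticles η.1 l)
      ≤ (N : ℝ) ^ l.length * ∑ ξ, ν ξ * g ξ.1 := by
  have hval : ∀ η, 0 ≤ value P Set.univ g η := fun η => by
    have := value_mono (P := P) (U := Set.univ) (g := fun _ => 0) (g' := g) (fun η _ => hg η) η
    rwa [value_const] at this
  induction l with
  | nil =>
    simp only [addParticles, List.foldl_nil, List.length_nil, pow_zero, one_mul]
    exact Finset.sum_le_sum fun η _ => by rw [value_of_stableOn (isStable_iff.1 η.2)]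
  | cons x l ih =>
    have h1 := hν.sum_mul_value_addParticle_le hN h0
      (g := fun η => value P Set.univ g (addParticles η l)) (fun η => hval _) x
    -- Stabilisation between the arrivals can be omitted.
    rw [← value_unique (harmonicAt_comp_addParticles (harmonicAt_value P Set.univ g) l)
      fun η _ => rfl] at h1
    refine h1.trans ?_
    rw [List.length_cons, pow_succ', mul_assoc]
    exact mul_le_mul_of_nonneg_left ih (by positivity)

/-- Every stationary measure is bounded below by a multiple of `fullMass`. -/
theorem IsStationaryMass.sum_mul_fullMass_le {P : Params} (hN : 1 ≤ N)
    {ν : StableConfig (segment N) → ℝ} (hν : IsStationaryMass P ν) (h0 : ∀ ξ, 0 ≤ ν ξ)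
    (ξ : StableConfig (segment N)) :
    (∑ η, ν η) * fullMass P ξ ≤ (N : ℝ) ^ (Finset.univ : Finset (segment N)).toList.length * ν ξ := by
  have h1 := hν.sum_mul_value_addParticles_le hN h0 (g := single ξ.1)
    (fun η => by unfold single; split_ifs <;> simp) (Finset.univ : Finset (segment N)).toList
  -- One arrival at each site makes all sites active, and the initial configuration is forgotten.
  have h2 : ∀ η : StableConfig (segment N), value P Set.univ (single ξ.1)
      (addParticles η.1 (Finset.univ : Finset (segment N)).toList) = fullMass P ξ := fun η =>
    value_of_forall_act _ _ fun x => act_addParticles (Or.inr (by simp))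
  have h3 : ∑ η : StableConfig (segment N), ν η * single ξ.1 η.1 = ν ξ := by
    rw [Finset.sum_eq_single ξ]
    · simp [single]
    · intro η _ h
      rw [single, if_neg (fun h' => h (Subtype.ext h')), mul_zero]
    · simp
  simp only [h2, h3] at h1
  rwa [Finset.sum_mul]

/-- Doeblin's argument. For the largest `c` with `c * fullMass ≤ π`, the remainder is stationary,
nonnegative and of mass `1 - c`, so it is at least `(1 - c) / K * fullMass`. Maximality forces `c =
1`, and then the remainder has mass `0`. -/
theorem IsStationaryMass.eq_fullMass {P : Params} (hN : 1 ≤ N)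
    {π : StableConfig (segment N) → ℝ} (hπ : IsStationaryMass P π) (h0 : ∀ ξ, 0 ≤ π ξ)
    (h1 : ∑ ξ, π ξ = 1) : π = fullMass P := by
  let S : Set ℝ := {c | ∀ ξ, c * fullMass P ξ ≤ π ξ}
  have hle : ∀ c ∈ S, c ≤ 1 := by
    intro c hc
    have := Finset.sum_le_sum fun ξ (_ : ξ ∈ Finset.univ) => hc ξ
    rwa [← Finset.mul_sum, sum_fullMass, h1, mul_one] at this
  have hclosed : IsClosed S := by
    have : S = ⋂ ξ, {c | c * fullMass P ξ ≤ π ξ} := by ext; simp [S]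
    rw [this]
    exact isClosed_iInter fun ξ => isClosed_le (continuous_id.mul continuous_const) continuous_const
  have hmem : sSup S ∈ S := hclosed.csSup_mem ⟨0, fun ξ => by simpa using h0 ξ⟩ ⟨1, hle⟩
  have hstat : IsStationaryMass P fun ξ => π ξ - sSup S * fullMass P ξ := by
    intro ξ
    have h2 := isStationaryMass_fullMass P hN ξ
    have h3 := hπ ξ
    simp only [sub_mul, Finset.sum_sub_distrib, mul_assoc]
    rw [← Finset.mul_sum, h2, h3]
  set K : ℝ := (N : ℝ) ^ (Finset.univ : Finset (segment N)).toList.length with hK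
  have hKpos : 0 < K := by positivity
  have hsum : ∑ ξ, (π ξ - sSup S * fullMass P ξ) = 1 - sSup S := by
    rw [Finset.sum_sub_distrib, ← Finset.mul_sum, sum_fullMass, h1, mul_one]
  have hnext : sSup S + (1 - sSup S) / K ∈ S := by
    intro ξ
    have := hstat.sum_mul_fullMass_le hN (fun ξ => sub_nonneg.2 (hmem ξ)) ξ
    rw [hsum, ← hK] at this
    have h4 : (1 - sSup S) / K * fullMass P ξ ≤ π ξ - sSup S * fullMass P ξ := by
      rw [div_mul_eq_mul_div, div_le_iff₀ hKpos]
      linarith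
    linarith
  have h5 : sSup S = 1 := by
    refine le_antisymm (hle _ hmem) ?_
    have h6 := le_csSup (⟨1, hle⟩ : BddAbove S) hnext
    have h7 : (1 - sSup S) / K ≤ 0 := by linarith
    rw [div_le_iff₀ hKpos, zero_mul] at h7
    linarith
  rw [h5] at hmem hsum
  funext ξ
  have h8 := (Finset.sum_eq_zero_iff_of_nonneg fun ξ _ => sub_nonneg.2 (hmem ξ)).1
    (hsum.trans (sub_self 1)) ξ (Finset.mem_univ ξ)
  linarith

variable {lam p : ℝ}

theorem IsStationary.toReal_eq_fullMass (hN : 1 ≤ N) (hlam : 0 < lam) (hp0 : 0 < p) (hp1 : p < 1)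
    {π : PMF (StableConfig (segment N))} (hπ : IsStationary lam p π)
    (ξ : StableConfig (segment N)) :
    (π ξ).toReal = fullMass (Params.ofRates lam p hlam hp0 hp1) ξ := by
  refine congrFun (((isStationary_iff hN hlam hp0 hp1 π).1 hπ).eq_fullMass hN
    (fun _ => ENNReal.toReal_nonneg) ?_) ξ
  have h := π.tsum_coe
  rw [tsum_fintype] at h
  rw [← ENNReal.toReal_sum fun ξ _ => π.apply_ne_top ξ, h, ENNReal.toReal_one]

theorem IsStationary.apply_eq (hN : 1 ≤ N) (hlam : 0 < lam) (hp0 : 0 < p) (hp1 : p < 1)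
    {π : PMF (StableConfig (segment N))} (hπ : IsStationary lam p π)
    (ξ : StableConfig (segment N)) :
    π ξ = ENNReal.ofReal (fullMass (Params.ofRates lam p hlam hp0 hp1) ξ) := by
  rw [← hπ.toReal_eq_fullMass hN hlam hp0 hp1, ENNReal.ofReal_toReal (π.apply_ne_top ξ)]

theorem existsUnique_isStationary (hN : 1 ≤ N) (hlam : 0 < lam) (hp0 : 0 < p) (hp1 : p < 1) :
    ∃! π : PMF (StableConfig (segment N)), IsStationary lam p π := by
  set P := Params.ofRates lam p hlam hp0 hp1
  refine ⟨PMF.ofFintype (fun ξ => ENNReal.ofReal (fullMass P ξ)) ?_, ?_, ?_⟩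
  · rw [← ENNReal.ofReal_sum_of_nonneg fun ξ _ => fullMass_nonneg P ξ, sum_fullMass,
      ENNReal.ofReal_one]
  · refine (isStationary_iff hN hlam hp0 hp1 _).2 ?_
    simp only [PMF.ofFintype_apply, ENNReal.toReal_ofReal (fullMass_nonneg P _)]
    exact isStationaryMass_fullMass P hN
  · intro π hπ
    ext ξ
    rw [hπ.apply_eq hN hlam hp0 hp1, PMF.ofFintype_apply]

end Stationarity

/-! ### One side of a site, and the order in which it is toppled -/

section Budget

variable {N : ℕ}

/-- No site of `B` contains a sleeping particle. -/
def NoSleep (B : Set ℤ) {V : Finset ℤ} (η : Config V) : Prop :=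
  ∀ x : V, (x : ℤ) ∈ B → η x ≠ .sleeping

/-- `B` and `O` are the two sides of `c`. -/
def IsSides (c : ℤ) (B O : Set ℤ) : Prop :=
  B = Set.Iio c ∧ O = Set.Ioi c ∨ B = Set.Ioi c ∧ O = Set.Iio c

section sides

variable {c : ℤ} {B O : Set ℤ}

theorem IsSides.symm (h : IsSides c B O) : IsSides c O B := by
  rcases h with ⟨rfl, rfl⟩ | ⟨rfl, rfl⟩
  · exact Or.inr ⟨rfl, rfl⟩
  · exact Or.inl ⟨rfl, rfl⟩

theorem IsSides.notMem (h : IsSides c B O) : c ∉ B := by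
  rcases h with ⟨rfl, rfl⟩ | ⟨rfl, rfl⟩ <;> simp

theorem IsSides.subset (h : IsSides c B O) : B ⊆ {c}ᶜ := by
  rintro x hx rfl
  exact h.notMem hx

theorem IsSides.mem_or_mem (h : IsSides c B O) {z : ℤ} (hz : z ≠ c) : z ∈ B ∨ z ∈ O := by
  rcases h with ⟨rfl, rfl⟩ | ⟨rfl, rfl⟩ <;> simp only [Set.mem_Iio, Set.mem_Ioi] <;> omega

theorem IsSides.not_near (h : IsSides c B O) {x z : ℤ} (hx : x ∈ B) (hz : z ∈ O) :
    z ≠ x ∧ z ≠ x - 1 ∧ z ≠ x + 1 := by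
  rcases h with ⟨rfl, rfl⟩ | ⟨rfl, rfl⟩ <;> simp only [Set.mem_Iio, Set.mem_Ioi] at hx hz <;> omega

theorem IsSides.eq_of_natAbs_eq (h : IsSides c B O) {x y : ℤ} (hx : x ∈ B) (hy : y ∈ B)
    (hxy : (x - c).natAbs = (y - c).natAbs) : x = y := by
  rcases h with ⟨rfl, rfl⟩ | ⟨rfl, rfl⟩ <;> simp only [Set.mem_Iio, Set.mem_Ioi] at hx hy <;> omega

end sides

theorem applyEvent_eq_sleeping {V : Finset ℤ} {η : Config V} {x z : V} (hx : Act η x) {e : Event}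
    (h : applyEvent η (x, e) z = .sleeping) : η z = .sleeping ∨ z = x ∧ e = .sleep := by
  rw [applyEvent_apply] at h
  by_cases hz : z = x
  · subst hz
    have hz := hx.ne_sleeping
    rcases h' : η z with k | _
    · cases e
      · simp [localEffect, h', SiteState.release] at h
      · simp [localEffect, h', SiteState.release] at h
      · exact Or.inr ⟨rfl, rfl⟩
    · exact absurd h' hz
  · left
    have hz' : (z : ℤ) ≠ x := fun h' => hz (Subtype.ext h')
    have hrec : (η z).receive ≠ .sleeping := by
      rcases η z with k | _ <;> simp [SiteState.receive]
    cases e <;> simp only [localEffect, hz', if_false] at h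
    · split_ifs at h
      · exact absurd h hrec
      · exact h
    · split_ifs at h
      · exact absurd h hrec
      · exact h
    · exact h

theorem act_of_act_applyEvent_sleep {V : Finset ℤ} {η : Config V} {x z : V} (hx : Act η x)
    (h : Act (applyEvent η (x, .sleep)) z) : Act η z := by
  by_cases hz : z = x
  · exact hz ▸ hx
  · simpa [Act, applyEvent, hz] using h

theorem stableOn_applyEvent {c : ℤ} {B O : Set ℤ} (h : IsSides c B O) {V : Finset ℤ}
    {η : Config V} (hη : StableOn O η) {x : V} (hx : (x : ℤ) ∈ B) (e : Event) :
    StableOn O (applyEvent η (x, e)) := by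
  intro z hz hact
  obtain ⟨-, h1, h2⟩ := h.not_near hx hz
  rcases act_applyEvent_cases hact with h' | h' | h'
  · exact hη z hz h'
  · exact h1 h'
  · exact h2 h'

theorem noSleep_applyEvent {B : Set ℤ} {V : Finset ℤ} {η : Config V} (hη : NoSleep B η) {x : V}
    (hx : Act η x) {e : Event} (he : (x : ℤ) ∉ B ∨ e ≠ .sleep) :
    NoSleep B (applyEvent η (x, e)) := by
  intro z hz h
  rcases applyEvent_eq_sleeping hx h with h | ⟨rfl, rfl⟩
  · exact hη z hz h
  · rcases he with he | he
    · exact he hz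
    · exact he rfl

open Classical in
/-- If the payoff is at least `0` whenever an active particle has reached `c` and the side `B` of
`c` has no sleeping particle, and it is `0` when no particle has reached `c`, then the value is at
least `0` if the side `B` has no sleeping particle at first: if the particles of `B` nearest to `c`
are moved first, the first particle that reaches `c` leaves no sleeping particle in `B`. -/
theorem value_nonneg_of_side {P : Params} {c : segment N} {B O : Set ℤ} (hBO : IsSides (c : ℤ) B O)
    {u : Config (segment N) → ℝ} (hu : ∀ η, Act η c → HarmonicAt P B u η)
    (hn : ∀ η, Act η c → NoSleep B η → 0 ≤ u η) {η : Config (segment N)} (hη : NoSleep B η) :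
    0 ≤ value P {(c : ℤ)}ᶜ (fun ξ => if Act ξ c then u ξ else 0) η := by
  set D := value P {(c : ℤ)}ᶜ fun ξ => if Act ξ c then u ξ else 0 with hD
  have hDh : ∀ η, HarmonicAt P {(c : ℤ)}ᶜ D η := harmonicAt_value P _ _
  have hst : ∀ η : Config (segment N), StableOn O η → StableOn B η → StableOn {(c : ℤ)}ᶜ η := by
    intro η h1 h2 x hx
    rcases hBO.mem_or_mem hx with h | h
    · exact h2 x h
    · exact h1 x h
  have hne : ∀ x : segment N, (x : ℤ) ∈ B → c ≠ x := by
    rintro x hx rfl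
    exact hBO.notMem hx
  -- With `O` stable and `c` active, only topplings in `B` remain, and they preserve the mean of
  -- `u`.
  have hreach : ∀ η ∈ {η : Config (segment N) | StableOn O η ∧ Act η c}, D η = u η := by
    refine eq_of_harmonicAt (P := P) (U := B) ?_ (fun η _ => (hDh η).mono hBO.subset)
      (fun η hη => hu η hη.2) ?_
    · rintro η ⟨h1, h2⟩ x hxB hx e
      exact ⟨stableOn_applyEvent hBO h1 hxB e, h2.applyEvent (hne x hxB) e⟩
    · rintro η ⟨h1, h2⟩ hs
      rw [hD, value_of_stableOn (hst η h1 hs), if_pos h2]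
  -- The invariant: in `B`, sleeping particles are nearer to `c` than active ones. Toppling the
  -- nearest active site keeps it until `c` becomes active. The particle that reaches `c` comes from
  -- distance `1`, so no sleeping particle can be nearer.
  have hbefore : ∀ η ∈ {η : Config (segment N) | StableOn O η ∧ ¬ Act η c ∧
      ∀ y x : segment N, (y : ℤ) ∈ B → (x : ℤ) ∈ B → η y = .sleeping → Act η x →
        ((y : ℤ) - c).natAbs < ((x : ℤ) - c).natAbs}, -D η ≤ 0 := by
    refine max_principle P.p_pos P.p_lt_one _ (fun η => -D η) ?_
    rintro η ⟨h1, h2, h3⟩ hpos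
    have hns : ¬ StableOn B η := by
      intro hs
      rw [hD, value_of_stableOn (hst η h1 hs), if_neg h2, neg_zero] at hpos
      exact lt_irrefl _ hpos
    simp only [StableOn, not_forall, not_not] at hns
    obtain ⟨x₀, hx₀B, hx₀⟩ := hns
    obtain ⟨x, ⟨hxB, hx⟩, hmin⟩ := Set.exists_min_image {x : segment N | (x : ℤ) ∈ B ∧ Act η x}
      (fun x => ((x : ℤ) - c).natAbs) (Set.toFinite _) ⟨x₀, hx₀B, hx₀⟩
    refine ⟨x, hx, P.s, P.s_nonneg, P.s_lt_one, ?_, fun e hpos' => ?_⟩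
    · have := hDh η x (hBO.subset hxB) hx
      unfold topple jumpAvg at this ⊢
      linarith
    have h1' := stableOn_applyEvent hBO h1 hxB e
    by_cases h2' : Act (applyEvent η (x, e)) c
    · exfalso
      have hes : e ≠ .sleep := by
        rintro rfl
        exact h2 (act_of_act_applyEvent_sleep hx h2')
      have hd : ((x : ℤ) - c).natAbs = 1 := by
        rcases act_applyEvent_cases h2' with h | h | h
        · exact absurd h h2
        · omega
        · omega
      have hno : NoSleep B (applyEvent η (x, e)) := by
        intro z hz h
        rcases applyEvent_eq_sleeping hx h with h | ⟨-, h⟩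
        · have := h3 z x hz hxB h hx
          exact hne z hz (Subtype.ext (by omega))
        · exact hes h
      rw [hreach _ ⟨h1', h2'⟩] at hpos'
      linarith [hn _ h2' hno]
    · refine ⟨h1', h2', fun y x' hy hx' hys hxa => ?_⟩
      have hyx : y ≠ x' := by
        rintro rfl
        exact hxa.ne_sleeping hys
      have hyx' : ((y : ℤ) - c).natAbs ≠ ((x' : ℤ) - c).natAbs := fun h =>
        hyx (Subtype.ext (hBO.eq_of_natAbs_eq hy hx' h))
      rcases applyEvent_eq_sleeping hx hys with h | ⟨rfl, rfl⟩
      · rcases act_applyEvent_cases hxa with h' | h' | h'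
        · exact h3 y x' hy hx' h h'
        · have := h3 y x hy hxB h hx
          omega
        · have := h3 y x hy hxB h hx
          omega
      · have := hmin x' ⟨hx', act_of_act_applyEvent_sleep hx hxa⟩
        omega
  -- The side `O` is stabilised first, which puts nothing to sleep in `B`.
  rw [← neg_nonpos]
  refine max_principle P.p_pos P.p_lt_one {η | NoSleep B η} (fun η => -D η) ?_ η hη
  intro η hη hpos
  by_cases hs : StableOn O η
  · exfalso
    by_cases hc : Act η c
    · rw [hreach η ⟨hs, hc⟩] at hpos
      linarith [hn η hc hη]
    · exact hpos.not_ge (hbefore η ⟨hs, hc, fun y x hy _ h => absurd h (hη y hy)⟩)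
  · simp only [StableOn, not_forall, not_not] at hs
    obtain ⟨x, hxO, hx⟩ := hs
    refine ⟨x, hx, P.s, P.s_nonneg, P.s_lt_one, ?_, fun e _ => ?_⟩
    · have := hDh η x (hBO.symm.subset hxO) hx
      unfold topple jumpAvg at this ⊢
      linarith
    · exact noSleep_applyEvent hη hx (Or.inl fun hxB => (hBO.not_near hxB hxO).1 rfl)

/-! ### Bounding the number of jumps from the separating site -/

section budget

variable (P : Params) (c : segment N) (t : ℕ)

open Classical in
/-- The probability that at least `t` particles stay outside `c` when the sites outside `c` are
stabilised, and then up to `j` times a particle jumps from `c` and the sites outside `c` are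
stabilised again. -/
noncomputable def budgetValue : ℕ → Config (segment N) → ℝ
  | 0 => value P {(c : ℤ)}ᶜ (atLeast {(c : ℤ)}ᶜ t)
  | j + 1 => value P {(c : ℤ)}ᶜ fun ξ =>
      if Act ξ c then jumpAvg P.p c (budgetValue j) ξ else atLeast {(c : ℤ)}ᶜ t ξ

open Classical in
/-- The contribution of the event `f` at the last jump to the increment of `budgetValue`. -/
noncomputable def budgetIncr (f : Event) : ℕ → Config (segment N) → ℝ
  | 0 => value P {(c : ℤ)}ᶜ fun ξ =>
      if Act ξ c then budgetValue P c t 0 (applyEvent ξ (c, f)) - budgetValue P c t 0 ξ else 0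
  | j + 1 => value P {(c : ℤ)}ᶜ fun ξ =>
      if Act ξ c then jumpAvg P.p c (budgetIncr f j) ξ else 0

open Classical in
/-- The probability that more than `j` jumps from `c` are needed until no site is active, if the
particles at `c` do not fall asleep. -/
noncomputable def overBudget : ℕ → Config (segment N) → ℝ
  | 0 => value P {(c : ℤ)}ᶜ fun ξ => if Act ξ c then 1 else 0
  | j + 1 => value P {(c : ℤ)}ᶜ fun ξ => if Act ξ c then jumpAvg P.p c (overBudget j) ξ else 0

variable {P c t}

theorem harmonicAt_budgetValue (j : ℕ) (η : Config (segment N)) :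
    HarmonicAt P {(c : ℤ)}ᶜ (budgetValue P c t j) η := by
  cases j <;> exact harmonicAt_value _ _ _ _

theorem harmonicAt_budgetIncr (f : Event) (j : ℕ) (η : Config (segment N)) :
    HarmonicAt P {(c : ℤ)}ᶜ (budgetIncr P c t f j) η := by
  cases j <;> exact harmonicAt_value _ _ _ _

theorem harmonicAt_overBudget (j : ℕ) (η : Config (segment N)) :
    HarmonicAt P {(c : ℤ)}ᶜ (overBudget P c j) η := by
  cases j <;> exact harmonicAt_value _ _ _ _

open Classical in
theorem budgetValue_succ_of_stableOn {η : Config (segment N)} (hs : StableOn {(c : ℤ)}ᶜ η) (j : ℕ) :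
    budgetValue P c t (j + 1) η =
      if Act η c then jumpAvg P.p c (budgetValue P c t j) η else atLeast {(c : ℤ)}ᶜ t η :=
  value_of_stableOn hs

/-- The two budgets act alike up to the last jump. Its directions are separated because each one
needs a different side to be free of sleeping particles. -/
theorem budgetValue_succ_sub (j : ℕ) (η : Config (segment N)) :
    budgetValue P c t (j + 1) η - budgetValue P c t j η
      = P.p * budgetIncr P c t .left j η + (1 - P.p) * budgetIncr P c t .right j η := by
  induction j generalizing η with
  | zero =>
    refine eq_of_harmonicAt (C := Set.univ) (P := P) (U := {(c : ℤ)}ᶜ) (fun _ _ _ _ _ _ => trivial)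
      (u := fun η => _) (v := fun η => _)
      (fun η _ => (harmonicAt_budgetValue 1 η).sub (harmonicAt_budgetValue 0 η))
      (fun η _ => ((harmonicAt_budgetIncr .left 0 η).const_mul _).add
        ((harmonicAt_budgetIncr .right 0 η).const_mul _)) ?_ η trivial
    intro η _ hs
    have h0 : budgetValue P c t 0 η = atLeast {(c : ℤ)}ᶜ t η := value_of_stableOn hs
    rw [budgetValue_succ_of_stableOn hs, budgetIncr, budgetIncr, value_of_stableOn hs,
      value_of_stableOn hs]
    split_ifs
    · unfold jumpAvg; ring
    · rw [h0]; ring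
  | succ j ih =>
    refine eq_of_harmonicAt (C := Set.univ) (P := P) (U := {(c : ℤ)}ᶜ) (fun _ _ _ _ _ _ => trivial)
      (u := fun η => _) (v := fun η => _)
      (fun η _ => (harmonicAt_budgetValue (j + 2) η).sub (harmonicAt_budgetValue (j + 1) η))
      (fun η _ => ((harmonicAt_budgetIncr .left (j + 1) η).const_mul _).add
        ((harmonicAt_budgetIncr .right (j + 1) η).const_mul _)) ?_ η trivial
    intro η _ hs
    rw [budgetValue_succ_of_stableOn hs, budgetValue_succ_of_stableOn hs, budgetIncr, budgetIncr,
      value_of_stableOn hs, value_of_stableOn hs]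
    split_ifs
    · have hl := ih (applyEvent η (c, .left))
      have hr := ih (applyEvent η (c, .right))
      unfold jumpAvg
      linear_combination P.p * hl + (1 - P.p) * hr
    · ring

/-- By `value_nonneg_of_side`, the side `B` may be assumed free of sleeping particles whenever a
particle jumps from `c`. The jump keeps it so, and `h0` applies at the last one. -/
theorem budgetIncr_nonneg {B O : Set ℤ} (hBO : IsSides (c : ℤ) B O) {f : Event}
    (h0 : ∀ η, Act η c → NoSleep B η →
      budgetValue P c t 0 η ≤ budgetValue P c t 0 (applyEvent η (c, f)))
    (j : ℕ) {η : Config (segment N)} (hη : NoSleep B η) : 0 ≤ budgetIncr P c t f j η := by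
  have hc : (c : ℤ) ∉ ({(c : ℤ)}ᶜ : Set ℤ) := fun h => h rfl
  induction j generalizing η with
  | zero =>
    refine value_nonneg_of_side hBO (u := fun η => budgetValue P c t 0 (applyEvent η (c, f))
      - budgetValue P c t 0 η) (fun η hact => ?_) (fun η hact hno => sub_nonneg.2 (h0 η hact hno)) hη
    exact ((HarmonicAt.comp_applyEvent (harmonicAt_budgetValue 0) hc f hact).sub
      (harmonicAt_budgetValue 0 η)).mono hBO.subset
  | succ j ih =>
    refine value_nonneg_of_side hBO (u := jumpAvg P.p c (budgetIncr P c t f j))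
      (fun η hact => ?_) (fun η hact hno => ?_) hη
    · exact (((HarmonicAt.comp_applyEvent (harmonicAt_budgetIncr f j) hc .left hact).const_mul
        P.p).add ((HarmonicAt.comp_applyEvent (harmonicAt_budgetIncr f j) hc .right hact).const_mul
        (1 - P.p))).mono hBO.subset
    · have hl := ih (noSleep_applyEvent (e := .left) hno hact (Or.inr (by simp)))
      have hr := ih (noSleep_applyEvent (e := .right) hno hact (Or.inr (by simp)))
      exact add_nonneg (mul_nonneg P.p_pos.le hl) (mul_nonneg (sub_nonneg.2 P.p_lt_one.le) hr)

theorem Params.jumpAvg_mono (P : Params) {V : Finset ℤ} (x : V) {u v : Config V → ℝ}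
    {η : Config V} (hl : u (applyEvent η (x, .left)) ≤ v (applyEvent η (x, .left)))
    (hr : u (applyEvent η (x, .right)) ≤ v (applyEvent η (x, .right))) :
    jumpAvg P.p x u η ≤ jumpAvg P.p x v η :=
  add_le_add (mul_le_mul_of_nonneg_left hl P.p_pos.le)
    (mul_le_mul_of_nonneg_left hr (sub_nonneg.2 P.p_lt_one.le))

theorem jumpAvg_const {V : Finset ℤ} (p a : ℝ) (x : V) (η : Config V) :
    jumpAvg p x (fun _ => a) η = a := by
  unfold jumpAvg; ring

theorem wakeAt_applyEvent_sleep {V : Finset ℤ} {η : Config V} {x : V} (h : Act η x) :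
    wakeAt (applyEvent η (x, .sleep)) x = η := by
  funext w
  by_cases hw : w = x
  · subst hw
    rcases h' : η w with (_ | _ | k) | _
    · simp [Act, h', SiteState.numActive] at h
    · simp [wakeAt, applyEvent, h', SiteState.fallAsleep, SiteState.wake]
    · simp [wakeAt, applyEvent, h', SiteState.fallAsleep, SiteState.wake]
    · exact absurd h' h.ne_sleeping
  · simp [wakeAt, applyEvent, hw]

/-- Particles that jump instead of falling asleep do not increase the probability that many
particles stay. -/
theorem jumpAvg_value_atLeast_le {U : Set ℤ} {x : segment N} (hxU : (x : ℤ) ∈ U)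
    {η : Config (segment N)} (hx : Act η x) :
    jumpAvg P.p x (value P U (atLeast U t)) η ≤ value P U (atLeast U t) η := by
  have h1 := harmonicAt_value P U (atLeast U t) η x hxU hx
  have h2 := value_atLeast_wakeAt_le P U t x (applyEvent η (x, .sleep))
  rw [wakeAt_applyEvent_sleep hx] at h2
  have h4 := mul_le_mul_of_nonneg_left h2 P.s_nonneg
  refine le_of_mul_le_mul_left ?_ (sub_pos.2 P.s_lt_one)
  unfold topple at h1
  linarith

theorem mass_mono {U U' : Set ℤ} (h : U ⊆ U') {V : Finset ℤ} (η : Config V) :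
    mass U η ≤ mass U' η := by
  refine Finset.sum_le_sum fun x _ => Nat.mul_le_mul_right _ ?_
  dsimp only
  split_ifs with h1 h2
  · rfl
  · exact absurd (h h1) h2
  · exact Nat.zero_le _
  · rfl

/-- An exhausted budget is paid for by `overBudget`. Otherwise the particles at `c` have always
jumped, whereas in the full stabilisation they may also sleep, which is no worse, and a particle
left at `c` counts too. -/
theorem budgetValue_le (j : ℕ) {η : Config (segment N)} (hη : η c ≠ .sleeping) :
    budgetValue P c t j η
      ≤ value P Set.univ (atLeast Set.univ t) η + overBudget P c j η := by
  have hcl : ∀ η ∈ {η : Config (segment N) | η c ≠ .sleeping}, ∀ x : segment N,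
      (x : ℤ) ∈ ({(c : ℤ)}ᶜ : Set ℤ) → Act η x → ∀ e,
      applyEvent η (x, e) ∈ {η : Config (segment N) | η c ≠ .sleeping} := by
    intro η hη x hxc hx e h
    rcases applyEvent_eq_sleeping hx h with h | ⟨rfl, -⟩
    · exact hη h
    · exact hxc rfl
  have hharm : ∀ η j, HarmonicAt P {(c : ℤ)}ᶜ (fun η : Config (segment N) =>
      value P Set.univ (atLeast Set.univ t) η + overBudget P c j η) η := fun η j =>
    ((harmonicAt_value P Set.univ _ η).mono (Set.subset_univ _)).add (harmonicAt_overBudget j η)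
  have h0 : ∀ η, 0 ≤ value P Set.univ (atLeast Set.univ t) η := fun η : Config (segment N) => by
    have := value_mono (P := P) (U := Set.univ) (g := fun _ : Config (segment N) => 0)
      (g' := atLeast Set.univ t) (fun η _ => by unfold atLeast; split_ifs <;> simp) η
    rwa [value_const] at this
  have hrest : ∀ η : Config (segment N), η c ≠ .sleeping → StableOn {(c : ℤ)}ᶜ η → ¬ Act η c →
      atLeast {(c : ℤ)}ᶜ t η ≤ value P Set.univ (atLeast Set.univ t) η := by
    intro η hη hs hc
    have hs' : StableOn Set.univ η := by
      intro x _
      by_cases hxc : (x : ℤ) = c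
      · rwa [Subtype.ext hxc]
      · exact hs x hxc
    rw [value_of_stableOn hs']
    unfold atLeast
    split_ifs with h1 h2
    · rfl
    · exact absurd (h1.trans (mass_mono (Set.subset_univ _) η)) h2
    · exact zero_le_one
    · rfl
  induction j generalizing η with
  | zero =>
    refine le_of_harmonicAt (P := P) hcl (fun η _ => harmonicAt_budgetValue 0 η)
      (fun η _ => hharm η 0) ?_ η hη
    intro η hη hs
    rw [budgetValue, overBudget, value_of_stableOn hs, value_of_stableOn hs]
    split_ifs with hc
    · have := h0 η
      have : atLeast {(c : ℤ)}ᶜ t η ≤ 1 := by unfold atLeast; split_ifs <;> simp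
      linarith
    · rw [add_zero]
      exact hrest η hη hs hc
  | succ j ih =>
    refine le_of_harmonicAt (P := P) hcl (fun η _ => harmonicAt_budgetValue (j + 1) η)
      (fun η _ => hharm η (j + 1)) ?_ η hη
    intro η hη hs
    rw [budgetValue, overBudget, value_of_stableOn hs, value_of_stableOn hs]
    split_ifs with hc
    · have hne : ∀ e ≠ Event.sleep, applyEvent η (c, e) c ≠ .sleeping := by
        intro e he h
        rcases applyEvent_eq_sleeping hc h with h | ⟨-, h⟩
        · exact hη h
        · exact he h
      have h1 := P.jumpAvg_mono c (v := fun η => value P Set.univ (atLeast Set.univ t) η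
        + overBudget P c j η) (ih (hne .left (by simp))) (ih (hne .right (by simp)))
      have h2 := jumpAvg_value_atLeast_le (P := P) (U := Set.univ) (t := t) trivial hc
      refine h1.trans ?_
      unfold jumpAvg at h2 ⊢
      linarith
    · rw [add_zero]
      exact hrest η hη hs hc

theorem overBudget_nonneg (j : ℕ) (η : Config (segment N)) : 0 ≤ overBudget P c j η := by
  induction j generalizing η with
  | zero =>
    have := value_mono (P := P) (U := {(c : ℤ)}ᶜ) (g := fun _ : Config (segment N) => 0)
      (g' := fun ξ => open Classical in if Act ξ c then 1 else 0)
      (fun η _ => by split_ifs <;> simp) η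
    rwa [value_const] at this
  | succ j ih =>
    have := value_mono (P := P) (U := {(c : ℤ)}ᶜ) (g := fun _ : Config (segment N) => 0)
      (g' := fun ξ => open Classical in if Act ξ c then jumpAvg P.p c (overBudget P c j) ξ else 0)
      (fun η _ => by
        split_ifs
        · rw [← jumpAvg_const P.p 0 c η]
          exact P.jumpAvg_mono c (ih _) (ih _)
        · exact le_rfl) η
    rwa [value_const] at this

theorem overBudget_succ_le (j : ℕ) (η : Config (segment N)) :
    overBudget P c (j + 1) η ≤ overBudget P c j η := by
  induction j generalizing η with
  | zero =>
    have hle : ∀ η, overBudget P c 0 η ≤ 1 := fun η => by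
      have := value_mono (P := P) (U := {(c : ℤ)}ᶜ) (g' := fun _ : Config (segment N) => 1)
        (g := fun ξ => open Classical in if Act ξ c then 1 else 0)
        (fun η _ => by split_ifs <;> simp) η
      rwa [value_const] at this
    refine value_mono (fun η _ => ?_) η
    split_ifs
    · rw [← jumpAvg_const P.p 1 c η]
      exact P.jumpAvg_mono c (hle _) (hle _)
    · exact le_rfl
  | succ j ih =>
    refine value_mono (fun η _ => ?_) η
    split_ifs
    · exact P.jumpAvg_mono c (ih _) (ih _)
    · exact le_rfl

/-- The limit is preserved by topplings outside `c` and, once these sites are stable, by jumps from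
`c`, which are topplings with `s = 0`. It vanishes where no site is active. The maximum principle
allows the sleep probability to vary. -/
theorem tendsto_overBudget (η : Config (segment N)) :
    Tendsto (fun j => overBudget P c j η) atTop (𝓝 0) := by
  have hlim : ∀ η, Tendsto (fun j => overBudget P c j η) atTop (𝓝 (⨅ j, overBudget P c j η)) :=
    fun η => tendsto_atTop_ciInf (antitone_nat_of_succ_le fun j => overBudget_succ_le j η)
      ⟨0, by rintro _ ⟨j, rfl⟩; exact overBudget_nonneg j η⟩
  have htop : ∀ s (x : segment N) η, Tendsto (fun j => topple s P.p x (overBudget P c j) η) atTop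
      (𝓝 (topple s P.p x (fun η => ⨅ j, overBudget P c j η) η)) := fun s x η =>
    ((hlim _).const_mul _).add ((((hlim _).const_mul _).add ((hlim _).const_mul _)).const_mul _)
  have hle : ∀ η ∈ (Set.univ : Set (Config (segment N))), ⨅ j, overBudget P c j η ≤ 0 := by
    refine max_principle P.p_pos P.p_lt_one _ (fun η => ⨅ j, overBudget P c j η) ?_
    intro η _ hpos
    by_cases hs : StableOn {(c : ℤ)}ᶜ η
    · by_cases hc : Act η c
      · refine ⟨c, hc, 0, le_rfl, one_pos, le_of_eq ?_, fun _ _ => trivial⟩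
        refine tendsto_nhds_unique ((tendsto_add_atTop_iff_nat 1).2 (hlim η))
          ((htop 0 c η).congr fun j => ?_)
        rw [overBudget, value_of_stableOn hs, if_pos hc]
        unfold topple
        ring
      · refine absurd (tendsto_nhds_unique ((tendsto_add_atTop_iff_nat 1).2 (hlim η))
          (tendsto_const_nhds.congr fun j => ?_)) hpos.ne'
        rw [overBudget, value_of_stableOn hs, if_neg hc]
    · simp only [StableOn, not_forall, not_not] at hs
      obtain ⟨x, hxc, hx⟩ := hs
      refine ⟨x, hx, P.s, P.s_nonneg, P.s_lt_one, le_of_eq ?_, fun _ _ => trivial⟩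
      exact tendsto_nhds_unique (hlim η)
        ((htop P.s x η).congr fun j => (harmonicAt_overBudget j η x hxc hx).symm)
  have h0 : ⨅ j, overBudget P c j η = 0 :=
    le_antisymm (hle η trivial) (Real.iInf_nonneg fun j => overBudget_nonneg j η)
  exact h0 ▸ hlim η

/-- Comparison of the stabilisation with the one in which the particles at `c` are stuck. -/
theorem value_compl_le_value_univ
    (hc : ∀ η η' : Config (segment N), (∀ z ≠ c, η z = η' z) →
      value P {(c : ℤ)}ᶜ (atLeast {(c : ℤ)}ᶜ t) η = value P {(c : ℤ)}ᶜ (atLeast {(c : ℤ)}ᶜ t) η')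
    {η : Config (segment N)} (hη : NoSleep Set.univ η) :
    value P {(c : ℤ)}ᶜ (atLeast {(c : ℤ)}ᶜ t) η ≤ value P Set.univ (atLeast Set.univ t) η := by
  have hcN := Finset.mem_Icc.1 c.2
  have hself : ∀ η, value P {(c : ℤ)}ᶜ (atLeast {(c : ℤ)}ᶜ t) η
      ≤ value P {(c : ℤ)}ᶜ (atLeast {(c : ℤ)}ᶜ t) (addParticle η c) := fun η =>
    (hc _ _ fun z hz => by
      have hz' : (z : ℤ) ≠ c := fun h => hz (Subtype.ext h)
      simp [addParticle, hz']).le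
  have hjump : ∀ (η : Config (segment N)) (y : ℤ),
      value P {(c : ℤ)}ᶜ (atLeast {(c : ℤ)}ᶜ t) (jump η c y)
        = value P {(c : ℤ)}ᶜ (atLeast {(c : ℤ)}ᶜ t) (addParticle η y) := fun η y =>
    hc _ _ fun z hz => by simp [jump, addParticle, hz]
  -- The interval runs from the killing site `0` to `c`, where particles are stuck and not counted;
  -- an arrival at either end leaves the value unchanged.
  have hl : ∀ j {η}, NoSleep (Set.Iio (c : ℤ)) η → 0 ≤ budgetIncr P c t .left j η := fun j {η} hη =>
    budgetIncr_nonneg (Or.inl ⟨rfl, rfl⟩) (fun η _ hη => by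
      simp only [budgetValue, applyEvent, hjump]
      refine value_atLeast_le_addParticle (a := 0) (b := c) t (fun z h1 h2 => ?_)
        (fun z _ h2 => hη z h2) ?_ (hself η) ⟨by omega, by omega⟩
      · exact ⟨Finset.mem_Icc.2 ⟨by omega, by omega⟩, h2.ne⟩
      · rw [addParticle_of_notMem _ (by simp [segment])]) j hη
  have hr : ∀ j {η}, NoSleep (Set.Ioi (c : ℤ)) η → 0 ≤ budgetIncr P c t .right j η := fun j {η} hη =>
    budgetIncr_nonneg (Or.inr ⟨rfl, rfl⟩) (fun η _ hη => by
      simp only [budgetValue, applyEvent, hjump]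
      refine value_atLeast_le_addParticle (a := c) (b := N + 1) t (fun z h1 h2 => ?_)
        (fun z h1 _ => hη z h1) (hself η) ?_ ⟨by omega, by omega⟩
      · exact ⟨Finset.mem_Icc.2 ⟨by omega, by omega⟩, h1.ne'⟩
      · rw [addParticle_of_notMem _ (by simp [segment])]) j hη
  have hmono : Monotone fun j => budgetValue P c t j η := monotone_nat_of_le_succ fun j => by
    have h1 := budgetValue_succ_sub (P := P) (c := c) (t := t) j η
    have h2 := mul_nonneg P.p_pos.le (hl j (η := η) fun x _ => hη x trivial)
    have h3 := mul_nonneg (sub_nonneg.2 P.p_lt_one.le) (hr j (η := η) fun x _ => hη x trivial)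
    linarith
  have hlim : Tendsto (fun j => value P Set.univ (atLeast Set.univ t) η + overBudget P c j η) atTop
      (𝓝 (value P Set.univ (atLeast Set.univ t) η + 0)) :=
    tendsto_const_nhds.add (tendsto_overBudget η)
  rw [add_zero] at hlim
  exact ge_of_tendsto' hlim fun j => (hmono (Nat.zero_le j)).trans (budgetValue_le j (hη c trivial))

end budget

end Budget

/-! ### Independence of the two sides of the middle site -/

section Product

section restrict

variable {n N : ℕ} {a : ℤ}

/-- The part of a configuration on a shifted segment. -/
def restrict (h : ∀ x ∈ segment n, x + a ∈ segment N) (η : Config (segment N)) :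
    Config (segment n) :=
  fun x => η ⟨x + a, h x x.2⟩

variable (h : ∀ x ∈ segment n, x + a ∈ segment N)

theorem localEffect_add (x a z : ℤ) (e : Event) (s : SiteState) :
    localEffect (x + a) e (z + a) s = localEffect x e z s := by
  have h1 : z + a = x + a - 1 ↔ z = x - 1 := by omega
  have h2 : z + a = x + a + 1 ↔ z = x + 1 := by omega
  cases e <;> simp only [localEffect, add_left_inj, h1, h2]

theorem restrict_applyEvent_of_eq (η : Config (segment N)) {x : segment N} {x' : segment n}
    (hx : (x : ℤ) = x' + a) (e : Event) :
    restrict h (applyEvent η (x, e)) = applyEvent (restrict h η) (x', e) := by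
  funext z
  rw [restrict, applyEvent_apply, applyEvent_apply, hx, localEffect_add]
  rfl

theorem restrict_applyEvent_of_far (η : Config (segment N)) {x : segment N}
    (hx : ∀ z ∈ segment n, z + a ≠ x - 1 ∧ z + a ≠ x ∧ z + a ≠ x + 1) (e : Event) :
    restrict h (applyEvent η (x, e)) = restrict h η := by
  funext z
  obtain ⟨h1, h2, h3⟩ := hx z z.2
  rw [restrict, applyEvent_apply]
  cases e <;> simp [localEffect, h1, h2, h3, restrict]

end restrict

variable {n m : ℕ}

theorem add_zero_mem_segment : ∀ x ∈ segment n, x + 0 ∈ segment (n + m + 1) := by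
  intro x hx
  have := Finset.mem_Icc.1 hx
  exact Finset.mem_Icc.2 ⟨by omega, by push_cast; omega⟩

theorem add_succ_mem_segment : ∀ x ∈ segment m, x + (n + 1) ∈ segment (n + m + 1) := by
  intro x hx
  have := Finset.mem_Icc.1 hx
  exact Finset.mem_Icc.2 ⟨by omega, by push_cast; omega⟩

/-- The part of a configuration on `{1, …, n}`. -/
def leftPart (η : Config (segment (n + m + 1))) : Config (segment n) :=
  restrict add_zero_mem_segment η

/-- The part of a configuration on `{n + 2, …, n + m + 1}`. -/
def rightPart (η : Config (segment (n + m + 1))) : Config (segment m) :=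
  restrict add_succ_mem_segment η

/-- The site that separates the two parts. -/
noncomputable def middle (n m : ℕ) : segment (n + m + 1) :=
  ⟨n + 1, Finset.mem_Icc.2 ⟨by omega, by push_cast; omega⟩⟩

theorem coe_middle : (middle n m : ℤ) = n + 1 := rfl

theorem mass_compl_middle (η : Config (segment (n + m + 1))) :
    mass {(middle n m : ℤ)}ᶜ η = total (leftPart η) + total (rightPart η) := by
  let φ : (segment n ⊕ segment m) ⊕ Unit → segment (n + m + 1) := Sum.elim (Sum.elim
    (fun x => ⟨x + 0, add_zero_mem_segment x x.2⟩)
    (fun x => ⟨x + (n + 1), add_succ_mem_segment x x.2⟩)) fun _ => middle n m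
  have hmem : ∀ {k : ℕ} (x : segment k), 1 ≤ (x : ℤ) ∧ (x : ℤ) ≤ k := fun x =>
    Finset.mem_Icc.1 x.2
  have hφ : φ.Bijective := by
    constructor
    · rintro ((x | x) | x) ((y | y) | y) h <;>
        have h := congrArg Subtype.val h <;>
        simp only [φ, Sum.elim_inl, Sum.elim_inr, coe_middle] at h
      · exact congrArg _ (congrArg _ (Subtype.ext (by omega)))
      · have := hmem x; have := hmem y; omega
      · have := hmem x; omega
      · have := hmem x; have := hmem y; omega
      · exact congrArg _ (congrArg _ (Subtype.ext (by omega)))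
      · have := hmem x; omega
      · have := hmem y; omega
      · have := hmem y; omega
      · rfl
    · intro z
      have hz := hmem z
      push_cast at hz
      rcases lt_trichotomy (z : ℤ) (n + 1) with h | h | h
      · exact ⟨Sum.inl (Sum.inl ⟨z, Finset.mem_Icc.2 ⟨by omega, by omega⟩⟩),
          Subtype.ext (add_zero _)⟩
      · exact ⟨Sum.inr (), Subtype.ext h.symm⟩
      · exact ⟨Sum.inl (Sum.inr ⟨z - (n + 1), Finset.mem_Icc.2 ⟨by omega, by omega⟩⟩),
          Subtype.ext (sub_add_cancel _ _)⟩
  unfold mass total weight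
  rw [← hφ.sum_comp, Fintype.sum_sum_type, Fintype.sum_sum_type]
  have h1 : ∀ x : segment n, (x : ℤ) ∈ ({(middle n m : ℤ)}ᶜ : Set ℤ) := by
    intro x h
    have := hmem x
    have : (x : ℤ) = n + 1 := h
    omega
  have h2 : ∀ x : segment m, (x : ℤ) + (n + 1) ∈ ({(middle n m : ℤ)}ᶜ : Set ℤ) := by
    intro x h
    have := hmem x
    have : (x : ℤ) + (n + 1) = n + 1 := h
    omega
  have h3 : (middle n m : ℤ) ∉ ({(middle n m : ℤ)}ᶜ : Set ℤ) := fun h => h rfl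
  simp only [φ, Sum.elim_inl, Sum.elim_inr, add_zero, if_pos (h1 _), if_pos (h2 _), if_neg h3,
    zero_mul, Finset.sum_const_zero, one_mul]
  simp [leftPart, rightPart, restrict]

/-- Each site except the middle one lies in a single part, and its topplings do not touch the other
part. A particle that reaches the middle site is lost to its part, as if killed. -/
theorem harmonicAt_mul_parts {P : Params} {u : Config (segment n) → ℝ} {v : Config (segment m) → ℝ}
    (hu : ∀ η, HarmonicAt P Set.univ u η) (hv : ∀ η, HarmonicAt P Set.univ v η)
    (η : Config (segment (n + m + 1))) :
    HarmonicAt P {(middle n m : ℤ)}ᶜ (fun η => u (leftPart η) * v (rightPart η)) η := by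
  intro x hxU hx
  have hxU : (x : ℤ) ≠ n + 1 := hxU
  have hmem := Finset.mem_Icc.1 x.2
  push_cast at hmem
  rcases lt_or_gt_of_ne hxU with h | h
  · let x' : segment n := ⟨x, Finset.mem_Icc.2 ⟨by omega, by omega⟩⟩
    have hx' : (x : ℤ) = x' + 0 := (add_zero _).symm
    have hl : ∀ e, leftPart (applyEvent η (x, e)) = applyEvent (leftPart η) (x', e) :=
      restrict_applyEvent_of_eq _ η hx'
    have hr : ∀ e, rightPart (applyEvent η (x, e)) = rightPart η :=
      restrict_applyEvent_of_far _ η fun z hz => by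
        have := Finset.mem_Icc.1 hz
        omega
    have hact : Act (leftPart η) x' := by
      have : (⟨x' + 0, add_zero_mem_segment x' x'.2⟩ : segment (n + m + 1)) = x :=
        Subtype.ext hx'.symm
      unfold Act leftPart restrict
      rwa [this]
    have := hu _ x' trivial hact
    simp only [topple, jumpAvg, hl, hr] at this ⊢
    linear_combination v (rightPart η) * this
  · let x' : segment m := ⟨x - (n + 1), Finset.mem_Icc.2 ⟨by omega, by omega⟩⟩
    have hx' : (x : ℤ) = x' + (n + 1) := (sub_add_cancel _ _).symm
    have hl : ∀ e, leftPart (applyEvent η (x, e)) = leftPart η :=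
      restrict_applyEvent_of_far _ η fun z hz => by
        have := Finset.mem_Icc.1 hz
        omega
    have hr : ∀ e, rightPart (applyEvent η (x, e)) = applyEvent (rightPart η) (x', e) :=
      restrict_applyEvent_of_eq _ η hx'
    have hact : Act (rightPart η) x' := by
      have : (⟨x' + (n + 1), add_succ_mem_segment x' x'.2⟩ : segment (n + m + 1)) = x :=
        Subtype.ext hx'.symm
      unfold Act rightPart restrict
      rwa [this]
    have := hv _ x' trivial hact
    simp only [topple, jumpAvg, hl, hr] at this ⊢
    linear_combination u (leftPart η) * this

/-- The two parts are stabilised independently if the particles at the middle site are stuck. -/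
theorem value_compl_middle (P : Params) (t : ℕ) (η : Config (segment (n + m + 1))) :
    value P {(middle n m : ℤ)}ᶜ (atLeast {(middle n m : ℤ)}ᶜ t) η
      = ∑ ξ : StableConfig (segment n), ∑ ζ : StableConfig (segment m),
        (if t ≤ total ξ.1 + total ζ.1 then 1 else 0) *
          (value P Set.univ (single ξ.1) (leftPart η) *
            value P Set.univ (single ζ.1) (rightPart η)) := by
  have hharm : ∀ η, HarmonicAt P {(middle n m : ℤ)}ᶜ (fun η : Config (segment (n + m + 1)) =>
      ∑ ξ : StableConfig (segment n), ∑ ζ : StableConfig (segment m),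
        (if t ≤ total ξ.1 + total ζ.1 then 1 else 0) *
          (value P Set.univ (single ξ.1) (leftPart η) *
            value P Set.univ (single ζ.1) (rightPart η))) η := fun η =>
    HarmonicAt.sum fun (ξ : StableConfig (segment n)) _ =>
      HarmonicAt.sum fun (ζ : StableConfig (segment m)) _ => HarmonicAt.const_mul
        (harmonicAt_mul_parts (harmonicAt_value P Set.univ (single ξ.1))
          (harmonicAt_value P Set.univ (single ζ.1)) η) _
  refine (congrFun (value_unique hharm fun η hs => ?_) η).symm
  have hl : IsStable (leftPart η) := isStable_iff.2 fun x _ => hs _ fun h => by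
    have h : (x : ℤ) + 0 = n + 1 := h
    have := Finset.mem_Icc.1 x.2
    omega
  have hr : IsStable (rightPart η) := isStable_iff.2 fun x _ => hs _ fun h => by
    have h : (x : ℤ) + (n + 1) = n + 1 := h
    have := Finset.mem_Icc.1 x.2
    omega
  simp only [value_of_stableOn (isStable_iff.1 hl), value_of_stableOn (isStable_iff.1 hr)]
  have h1 : ∀ ξ : StableConfig (segment n), ∑ ζ : StableConfig (segment m),
      (if t ≤ total ξ.1 + total ζ.1 then (1 : ℝ) else 0) *
        (single ξ.1 (leftPart η) * single ζ.1 (rightPart η))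
      = (if t ≤ total ξ.1 + total (rightPart η) then 1 else 0) * single ξ.1 (leftPart η) := by
    intro ξ
    rw [← sum_single (fun ζ => (if t ≤ total ξ.1 + total ζ then (1 : ℝ) else 0)) hr, Finset.sum_mul]
    exact Finset.sum_congr rfl fun ζ _ => by ring
  simp only [h1]
  rw [sum_single (fun ξ => (if t ≤ total ξ + total (rightPart η) then (1 : ℝ) else 0)) hl, atLeast,
    mass_compl_middle]

/-- Both parts of `full` are again `full`, so the stabilisation with a stuck middle site yields two
independent stationary samples. -/
theorem value_compl_middle_le (P : Params) (t : ℕ) :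
    ∑ ξ : StableConfig (segment n), ∑ ζ : StableConfig (segment m),
        (if t ≤ total ξ.1 + total ζ.1 then 1 else 0) * (fullMass P ξ * fullMass P ζ)
      ≤ ∑ ξ : StableConfig (segment (n + m + 1)), fullMass P ξ * atLeast Set.univ t ξ.1 := by
  have h := value_compl_middle P t (full (segment (n + m + 1)))
  have hle := value_compl_le_value_univ (P := P) (c := middle n m) (t := t)
    (η := full (segment (n + m + 1))) ?_ fun x _ => by simp [full]
  · rw [sum_fullMass_mul]
    exact h ▸ hle
  · intro η η' hη
    have hl : leftPart η = leftPart η' := by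
      funext x
      refine hη _ fun h => ?_
      have h : (x : ℤ) + 0 = n + 1 := congrArg Subtype.val h
      have := Finset.mem_Icc.1 x.2
      omega
    have hr : rightPart η = rightPart η' := by
      funext x
      refine hη _ fun h => ?_
      have h : (x : ℤ) + (n + 1) = n + 1 := congrArg Subtype.val h
      have := Finset.mem_Icc.1 x.2
      omega
    rw [value_compl_middle, value_compl_middle, hl, hr]

theorem total_eq_countSleeping {V : Finset ℤ} (ξ : StableConfig V) :
    total ξ.1 = countSleeping ξ := by
  simp only [total, weight, one_mul, countSleeping]
  refine Finset.sum_congr rfl fun x _ => ?_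
  rw [SiteState.count, ξ.2 x, zero_add]

theorem mass_univ {V : Finset ℤ} (η : Config V) : mass Set.univ η = total η := by
  simp [mass, total]

theorem sleepingLaw_eq_sum {V : Finset ℤ} (π : PMF (StableConfig V)) :
    sleepingLaw π = ∑ ξ, π ξ • Measure.dirac (countSleeping ξ) := by
  classical
  ext A hA
  rw [sleepingLaw, PMF.toMeasure_apply_eq_toOuterMeasure, PMF.toOuterMeasure_map_apply,
    PMF.toOuterMeasure_apply_fintype, Measure.finsetSum_apply]
  refine Finset.sum_congr rfl fun ξ _ => ?_
  simp [Set.indicator_apply]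

instance {V : Finset ℤ} (π : PMF (StableConfig V)) : IsProbabilityMeasure (sleepingLaw π) :=
  inferInstanceAs (IsProbabilityMeasure (π.map countSleeping).toMeasure)

end Product

end ARW

/-- For every sleep rate `lam > 0` and every left-jump probability `p ∈ (0, 1)`: the
driven-dissipative chain on `{1, …, k}` has exactly one stationary distribution, and if `Sn`, `Sm`
are independent and `Sn`, `Sm`, `SN` are distributed as the numbers of sleeping particles under
the stationary distributions on `{1, …, n}`, `{1, …, m}` and `{1, …, n + m + 1}`, then `SN`
stochastically dominates `Sn + Sm`. -/
theorem proposition5 (lam p : ℝ) (hlam : 0 < lam) (hp0 : 0 < p) (hp1 : p < 1) :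
    (∀ k : ℕ, 1 ≤ k →
      ∃! π : PMF (ARW.StableConfig (ARW.segment k)), ARW.IsStationary lam p π) ∧
    ∀ n m : ℕ, 1 ≤ n → 1 ≤ m →
      ∀ (πn : PMF (ARW.StableConfig (ARW.segment n)))
        (πm : PMF (ARW.StableConfig (ARW.segment m)))
        (πN : PMF (ARW.StableConfig (ARW.segment (n + m + 1)))),
        ARW.IsStationary lam p πn → ARW.IsStationary lam p πm → ARW.IsStationary lam p πN →
        ∀ {Ω Ω' : Type*} [MeasurableSpace Ω] [MeasurableSpace Ω']
          (P : Measure Ω) (P' : Measure Ω') [IsProbabilityMeasure P] [IsProbabilityMeasure P']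
          (Sn Sm : Ω → ℕ) (SN : Ω' → ℕ),
          HasLaw Sn (ARW.sleepingLaw πn) P → HasLaw Sm (ARW.sleepingLaw πm) P →
          IndepFun Sn Sm P → HasLaw SN (ARW.sleepingLaw πN) P' →
          ∀ t : ℕ, P {ω | t ≤ Sn ω + Sm ω} ≤ P' {ω | t ≤ SN ω} := by
  refine ⟨fun k hk => ARW.existsUnique_isStationary hk hlam hp0 hp1, ?_⟩
  intro n m hn hm πn πm πN hπn hπm hπN Ω Ω' _ _ P P' _ _ Sn Sm SN hSn hSm hind hSN t
  set R := ARW.Params.ofRates lam p hlam hp0 hp1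
  -- By independence the joint law is a product, so both tails become finite sums over `fullMass`,
  -- to be compared by `value_compl_middle_le`.
  have hL : P {ω | t ≤ Sn ω + Sm ω} = ∑ ξ : ARW.StableConfig (ARW.segment n),
      ∑ ζ : ARW.StableConfig (ARW.segment m), ENNReal.ofReal
        ((if t ≤ ARW.total ξ.1 + ARW.total ζ.1 then 1 else 0) *
          (ARW.fullMass R ξ * ARW.fullMass R ζ)) := by
    have hA : MeasurableSet {q : ℕ × ℕ | t ≤ q.1 + q.2} := .of_discrete
    have h1 : P {ω | t ≤ Sn ω + Sm ω} = (P.map fun ω => (Sn ω, Sm ω)) {q | t ≤ q.1 + q.2} := by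
      rw [Measure.map_apply_of_aemeasurable (hSn.aemeasurable.prodMk hSm.aemeasurable) hA]
      rfl
    rw [h1, (indepFun_iff_map_prod_eq_prod_map_map hSn.aemeasurable hSm.aemeasurable).1 hind,
      hSn.map_eq, hSm.map_eq, Measure.prod_apply hA, ARW.sleepingLaw_eq_sum πn,
      lintegral_finsetSum_measure]
    refine Finset.sum_congr rfl fun ξ _ => ?_
    rw [lintegral_smul_measure, lintegral_dirac, ARW.sleepingLaw_eq_sum πm,
      Measure.finsetSum_apply, smul_eq_mul, Finset.mul_sum]
    refine Finset.sum_congr rfl fun ζ _ => ?_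
    rw [Measure.smul_apply, Measure.dirac_apply, ARW.total_eq_countSleeping,
      ARW.total_eq_countSleeping, hπn.apply_eq hn hlam hp0 hp1, hπm.apply_eq hm hlam hp0 hp1]
    by_cases h : t ≤ ARW.countSleeping ξ + ARW.countSleeping ζ
    · simp [h, ENNReal.ofReal_mul (ARW.fullMass_nonneg R ξ), R]
    · simp [h]
  have hR : P' {ω | t ≤ SN ω} = ∑ ξ : ARW.StableConfig (ARW.segment (n + m + 1)),
      ENNReal.ofReal (ARW.fullMass R ξ * ARW.atLeast Set.univ t ξ.1) := by
    have hA : MeasurableSet {k : ℕ | t ≤ k} := .of_discrete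
    have h1 : P' {ω | t ≤ SN ω} = (P'.map SN) {k | t ≤ k} := by
      rw [Measure.map_apply_of_aemeasurable hSN.aemeasurable hA]
      rfl
    rw [h1, hSN.map_eq, ARW.sleepingLaw_eq_sum πN, Measure.finsetSum_apply]
    refine Finset.sum_congr rfl fun ξ _ => ?_
    rw [Measure.smul_apply, Measure.dirac_apply, hπN.apply_eq (by omega) hlam hp0 hp1,
      ARW.atLeast, ARW.mass_univ, ARW.total_eq_countSleeping]
    by_cases h : t ≤ ARW.countSleeping ξ
    · simp [h, R]
    · simp [h]
  have hnn : ∀ (q : Prop) [Decidable q], (0 : ℝ) ≤ if q then 1 else 0 := fun q _ => by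
    split_ifs <;> simp
  have hnn₂ : ∀ (ξ : ARW.StableConfig (ARW.segment n)) (ζ : ARW.StableConfig (ARW.segment m)),
      0 ≤ (if t ≤ ARW.total ξ.1 + ARW.total ζ.1 then (1 : ℝ) else 0) *
        (ARW.fullMass R ξ * ARW.fullMass R ζ) := fun ξ ζ =>
    mul_nonneg (hnn _) (mul_nonneg (ARW.fullMass_nonneg R ξ) (ARW.fullMass_nonneg R ζ))
  rw [hL, hR, ← ENNReal.ofReal_sum_of_nonneg fun ξ _ =>
    mul_nonneg (ARW.fullMass_nonneg R ξ)
      (show 0 ≤ ARW.atLeast Set.univ t ξ.1 from hnn _)]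
  simp only [← ENNReal.ofReal_sum_of_nonneg fun ζ _ => hnn₂ _ ζ]
  rw [← ENNReal.ofReal_sum_of_nonneg fun ξ _ => Finset.sum_nonneg fun ζ _ => hnn₂ ξ ζ]
  exact ENNReal.ofReal_le_ofReal (ARW.value_compl_middle_le R t)
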